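/- **Conventions.** Let $M$ be a smooth manifold (finite-dimensional, Hausdorff) with a 2-plectic form $\omega$, i.e. a closed 3-form such that $\iota_u\omega=0$ with $u\in T_xM$ implies $u=0$. For vector fields $X,Y$ and bivector fields $v$ put $(\iota_X a)(\cdot)=a(X,\cdot)$, $\iota_{X\wedge Y}=\iota_Y\iota_X$, $\iota_{v\wedge X}=\iota_X\iota_v$; $[\cdot,\cdot]$ is the Schouten bracket, so $[X,Y\wedge Z]=[X,Y]\wedge Z+Y\wedge[X,Z]$ and $[v,X]=-[X,v]$. A *Lie 2-algebra* is a real vector space $\mathfrak g=\mathfrak g_{-1}\oplus\mathfrak g_0$ with a linear map $l_1:\mathfrak g_{-1}\to\mathfrak g_0$, a bilinear bracket $l_2$ that is skew on $\mathfrak g_0\times\mathfrak g_0$ with values in $\mathfrak g_0$, and with values in $\mathfrak g_{-1}$ and $l_2(x,a)=-l_2(a,x)$ for $a\in\mathfrak g_{-1}$, $x\in\mathfrak g_0$, and an alternating trilinear map $l_3:\mathfrak g_0^3\to\mathfrak g_{-1}$ such that, for $x,y,z,t\in\mathfrak g_0$ and $a,b\in\mathfrak g_{-1}$: * $l_1l_2(x,a)=l_2(x,l_1a)$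 and $l_2(l_1a,b)=l_2(a,l_1b)$; * $l_1l_3(x,y,z)=-l_2(l_2(x,y),z)-l_2(l_2(y,z),x)-l_2(l_2(z,x),y)$; * $l_3(l_1a,x,y)=l_2(a,l_2(x,y))+l_2(l_2(a,y),x)-l_2(l_2(a,x),y)$; * $l_3(l_2(x,y),z,t)-l_3(l_2(x,z),y,t)+l_3(l_2(x,t),y,z)+l_3(l_2(y,z),x,t)-l_3(l_2(y,t),x,z)+l_3(l_2(z,t),x,y)=l_2(l_3(x,y,z),t)-l_2(l_3(x,y,t),z)+l_2(l_3(x,z,t),y)-l_2(l_3(y,z,t),x)$. A *morphism* $F:\mathfrak g\to\mathfrak g'$ consists of linear maps $F_{1,0}:\mathfrak g_0\to\mathfrak g_0'$, $F_{1,-1}:\mathfrak g_{-1}\to\mathfrak g'_{-1}$ and an alternating bilinear map $F_2:\mathfrak g_0^2\to\mathfrak g_{-1}'$ such that * $l_1'F_{1,-1}(a)=F_{1,0}(l_1a)$ and $l_1'F_2(x,y)=F_{1,0}(l_2(x,y))-l_2'(F_{1,0}x,F_{1,0}y)$; * $F_{1,-1}(l_2(a,x))=F_2(l_1a,x)+l_2'(F_{1,-1}a,F_{1,0}x)$;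 * $F_{1,-1}(l_3(x,y,z))+\sum_{\rm cyc}F_2(l_2(x,y),z)=l_3'(F_{1,0}x,F_{1,0}y,F_{1,0}z)+\sum_{\rm cyc}l_2'(F_{1,0}x,F_2(y,z))$, with cyclic sums over $(x,y,z)$. It is *strict* if $F_2=0$. The composite $G\circ F$ has components $G_{1,0}F_{1,0}$, $G_{1,-1}F_{1,-1}$ and $(G\circ F)_2(x,y)=G_2(F_{1,0}x,F_{1,0}y)+G_{1,-1}F_2(x,y)$. **The Lie 2-algebras on $M$.** A 1-form $\alpha$ is in $\Omega^1_{Ham}(M)$ if $d\alpha=-\iota_{X_\alpha}\omega$ for a (unique) vector field $X_\alpha$; a vector field of the form $X_\alpha$ is called Hamiltonian. A pair $(f,v)$ of a smooth function and a bivector field is in $Ham^0(M)$ if $df=-\iota_v\omega$. * $\mathfrak X^2(M)\oplus\mathfrak X^1(M)$: bivector fields in degree $-1$, vector fields in degree $0$; $l_1=0$, $l_3=0$, and $l_2$ is the Schouten bracket. * $\mathsf{L^2(M,\omega)}=C^\infty(M)\oplus\Omega^1_{Ham}(M)$: $l_1(f)=df$, $l_2(\alpha,\beta)=\iota_{X_\alpha\wedge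 X_\beta}\omega$, $l_2(f,\alpha)=0$, $l_3(\alpha,\beta,\gamma)=-\omega(X_\alpha,X_\beta,X_\gamma)$. * $\mathsf{\widetilde{D^2(M,\omega)}}=(C^\infty(M)\times Ham^0(M))\oplus\Omega^1_{Ham}(M)$: $l_1(f',(f,v))=df'$, $l_2(\alpha,\beta)=\iota_{X_\alpha\wedge X_\beta}\omega$, $l_2((f',(f,v)),\alpha)=(0,(\iota_{v\wedge X_\alpha}\omega,[v,X_\alpha]))$, $l_3(\alpha,\beta,\gamma)=(-\omega(X_\alpha,X_\beta,X_\gamma),(0,0))$. There are strict morphisms $I:\mathsf{L^2(M,\omega)}\to\mathsf{\widetilde{D^2(M,\omega)}}$ with $I_{1,0}=\mathrm{id}$, $I_{1,-1}(f')=(f',(0,0))$; $\Phi:\mathsf{\widetilde{D^2(M,\omega)}}\to\mathsf{L^2(M,\omega)}$ with $\Phi_{1,0}=\mathrm{id}$, $\Phi_{1,-1}(f',(f,v))=f'$; and $\Psi:\mathsf{\widetilde{D^2(M,\omega)}}\to\mathfrak X^2(M)\oplus\mathfrak X^1(M)$ with $\Psi_{1,0}(\alpha)=X_\alpha$, $\Psi_{1,-1}(f',(f,v))=v$.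 **Actions and comomentum maps.** Let $\mathfrak g=\mathfrak g_{-1}\oplus\mathfrak g_0$ be a real Lie 2-algebra (of any dimension) such that $(\mathfrak g_0,l_2)$ is a Lie algebra. * A *2-action* of $\mathfrak g$ on $M$ is a morphism $\rho:\mathfrak g\to\mathfrak X^2(M)\oplus\mathfrak X^1(M)$. A *2-comomentum map* for $\rho$ along $\Psi$ is a morphism $\lambda:\mathfrak g\to\mathsf{\widetilde{D^2(M,\omega)}}$ with $\Psi\circ\lambda=\rho$. * An *infinitesimal action of $\mathfrak g_0$ by Hamiltonian vector fields* is a linear map $\rho^{\mathfrak g_0}:\mathfrak g_0\to\mathfrak X^1(M)$ whose values are Hamiltonian and which satisfies $\rho^{\mathfrak g_0}(l_2(x,y))=[\rho^{\mathfrak g_0}(x),\rho^{\mathfrak g_0}(y)]$. A *homotopy comomentum map* for it is a morphism $\lambda^{\mathfrak g}:\mathfrak g\to\mathsf{L^2(M,\omega)}$ with $d(\lambda^{\mathfrak g}_{1,0}(x))=-\iota_{\rho^{\mathfrak g_0}(x)}\omega$ for all $x\in\mathfrak g_0$. **Theorem.** 1. Let $\lambda^{\mathfrak g}$ be a homotopy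 comomentum map for an infinitesimal action $\rho^{\mathfrak g_0}$ of $\mathfrak g_0$ by Hamiltonian vector fields. Then $\rho=(\rho_{1,0},\rho_{1,-1},\rho_2)=(\rho^{\mathfrak g_0},0,0)$ is a 2-action, and $I\circ\lambda^{\mathfrak g}$ is a 2-comomentum map for $\rho$ along $\Psi$. 2. Conversely, let $\rho$ be a 2-action with $\rho_{1,-1}=0$ and $\rho_2=0$, and let $\lambda$ be a 2-comomentum map for $\rho$ along $\Psi$. Then $\rho_{1,0}$ is an infinitesimal action of $\mathfrak g_0$ by Hamiltonian vector fields, and $\Phi\circ\lambda$ is a homotopy comomentum map for it. -/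

import Mathlib

open scoped Manifold ContDiff Topology
set_option maxSynthPendingDepth 3

noncomputable section

namespace Plectic

section

variable {E : Type*} [NormedAddCommGroup E] [NormedSpace ℝ E] [FiniteDimensional ℝ E]
  {M : Type*} [TopologicalSpace M] [ChartedSpace E M] [IsManifold 𝓘(ℝ, E) ∞ M]

/-- The differential at `y` of the chart centred at `x₀`. Mathlib's tangent space at `y` is a copy
of the model space `E`, identified with `E` through the preferred chart at `y`. -/
def dChart (x₀ y : M) : E →L[ℝ] E := mfderiv 𝓘(ℝ, E) 𝓘(ℝ, E) (extChartAt 𝓘(ℝ, E) x₀) y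
/-- The differential at `u` of the inverse of the chart centred at `x₀`. -/
def dChartSymm (x₀ : M) (u : E) : E →L[ℝ] E :=
  mfderiv 𝓘(ℝ, E) 𝓘(ℝ, E) (extChartAt 𝓘(ℝ, E) x₀).symm u

lemma dChart_comp_symm {x₀ : M} {u : E} (hu : u ∈ (extChartAt 𝓘(ℝ, E) x₀).target) (v : E) :
    dChart x₀ ((extChartAt 𝓘(ℝ, E) x₀).symm u) (dChartSymm x₀ u v) = v := by
  have := mfderiv_extChartAt_comp_mfderivWithin_extChartAt_symm (I := 𝓘(ℝ, E)) hu
  rw [modelWithCornersSelf_coe, Set.range_id, mfderivWithin_univ] at this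
  exact congrArg (fun f : E →L[ℝ] E => f v) this

lemma dChartSymm_comp {x₀ : M} {u : E} (hu : u ∈ (extChartAt 𝓘(ℝ, E) x₀).target) (v : E) :
    dChartSymm x₀ u (dChart x₀ ((extChartAt 𝓘(ℝ, E) x₀).symm u) v) = v := by
  have := mfderivWithin_extChartAt_symm_comp_mfderiv_extChartAt (I := 𝓘(ℝ, E)) hu
  rw [modelWithCornersSelf_coe, Set.range_id, mfderivWithin_univ] at this
  exact congrArg (fun f : E →L[ℝ] E => f v) this

lemma dChart_self (x₀ : M) : dChart x₀ x₀ = ContinuousLinearMap.id ℝ E :=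
  mfderiv_extChartAt_self (I := 𝓘(ℝ, E))

lemma dChartSymm_self (x₀ : M) : dChartSymm x₀ (extChartAt 𝓘(ℝ, E) x₀ x₀)
    = ContinuousLinearMap.id ℝ E := by
  have := mfderivWithin_range_extChartAt_symm (I := 𝓘(ℝ, E)) (x := x₀)
  rw [modelWithCornersSelf_coe, Set.range_id, mfderivWithin_univ] at this
  exact this

/-- Smooth vector fields on `M`. -/
abbrev VF (E : Type*) [NormedAddCommGroup E] [NormedSpace ℝ E] (M : Type*) [TopologicalSpace M]
  [ChartedSpace E M] [IsManifold 𝓘(ℝ, E) ∞ M] :=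
  Cₛ^∞⟮𝓘(ℝ, E); E, (fun x : M => TangentSpace 𝓘(ℝ, E) x)⟯

/-- The coordinate expression of a vector field in the chart centred at `x₀`. -/
def vecRep (X : VF E M) (x₀ : M) (u : E) : E :=
  dChart x₀ ((extChartAt 𝓘(ℝ, E) x₀).symm u) (X ((extChartAt 𝓘(ℝ, E) x₀).symm u))

/-- The coordinate expression of a differential form in the chart centred at `x₀`. -/
def altRep {k : ℕ} (a : M → E [⋀^Fin k]→L[ℝ] ℝ) (x₀ : M) (u : E) : E [⋀^Fin k]→L[ℝ] ℝ :=
  (a ((extChartAt 𝓘(ℝ, E) x₀).symm u)).compContinuousLinearMap (dChartSymm x₀ u)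

lemma vecRep_eq_mpullback (X : VF E M) (x₀ : M) (u : E) (hu : u ∈ (extChartAt 𝓘(ℝ, E) x₀).target) :
    vecRep X x₀ u =
    VectorField.mpullback 𝓘(ℝ, E) 𝓘(ℝ, E) (extChartAt 𝓘(ℝ, E) x₀).symm X u := by
  rw [VectorField.mpullback_apply]
  have h1 : (dChartSymm x₀ u).inverse = dChart x₀ ((extChartAt 𝓘(ℝ, E) x₀).symm u) := by
    apply ContinuousLinearMap.inverse_eq
    · ext v; exact dChartSymm_comp hu v
    · ext v; exact dChart_comp_symm hu v
  exact congrArg (fun f : E →L[ℝ] E => f (X ((extChartAt 𝓘(ℝ, E) x₀).symm u))) h1.symm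

lemma isOpen_tgt (x₀ : M) : IsOpen (extChartAt 𝓘(ℝ, E) x₀).target := isOpen_extChartAt_target x₀

lemma vecRep_smooth (X : VF E M) (x₀ : M) :
    ContDiffOn ℝ ∞ (vecRep X x₀) (extChartAt 𝓘(ℝ, E) x₀).target := by
  refine ContDiffOn.congr ?_ (fun u hu => vecRep_eq_mpullback X x₀ u hu)
  rw [← contMDiffOn_vectorSpace_iff_contDiffOn]
  intro u hu
  have := isInvertible_mfderivWithin_extChartAt_symm (I := 𝓘(ℝ, E)) hu
  rw [modelWithCornersSelf_coe, Set.range_id, mfderivWithin_univ] at this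
  apply ContMDiffAt.contMDiffWithinAt
  refine ContMDiffAt.mpullback_vectorField_preimage (n := ∞) ?_ ?_ this (by simp)
  · exact X.contMDiff _
  · exact (contMDiffOn_extChartAt_symm (n := ∞) x₀).contMDiffAt ((isOpen_tgt x₀).mem_nhds hu)

lemma two_le : (2 : WithTop ℕ∞) ≤ ∞ := WithTop.coe_le_coe.2 (le_top : (2 : ℕ∞) ≤ ⊤)

lemma tgt_nhds (x₀ : M) : (extChartAt 𝓘(ℝ, E) x₀).target ∈ 𝓝 (extChartAt 𝓘(ℝ, E) x₀ x₀) :=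
  extChartAt_target_mem_nhds x₀

lemma rep_smooth {f : M → ℝ} (hf : ContMDiff 𝓘(ℝ, E) 𝓘(ℝ, ℝ) ∞ f) (x₀ : M) :
    ContDiffOn ℝ ∞ (f ∘ (extChartAt 𝓘(ℝ, E) x₀).symm) (extChartAt 𝓘(ℝ, E) x₀).target :=
  contMDiffOn_iff_contDiffOn.1 (hf.comp_contMDiffOn (contMDiffOn_extChartAt_symm x₀))

lemma smooth_of_rep {f : M → ℝ} (hf : ∀ x₀ : M, ContDiffOn ℝ ∞
    (f ∘ (extChartAt 𝓘(ℝ, E) x₀).symm) (extChartAt 𝓘(ℝ, E) x₀).target) :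
    ContMDiff 𝓘(ℝ, E) 𝓘(ℝ, ℝ) ∞ f := by
  intro x₀
  have h1 : ContMDiffOn 𝓘(ℝ, E) 𝓘(ℝ, ℝ) ∞
      ((f ∘ (extChartAt 𝓘(ℝ, E) x₀).symm) ∘ extChartAt 𝓘(ℝ, E) x₀) (chartAt E x₀).source :=
    (contMDiffOn_iff_contDiffOn.2 (hf x₀)).comp contMDiffOn_extChartAt
      (fun y hy => (extChartAt 𝓘(ℝ, E) x₀).map_source (by simpa using hy))
  have h2 := h1.contMDiffAt ((chartAt E x₀).open_source.mem_nhds (mem_chart_source E x₀))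
  refine h2.congr_of_eventuallyEq ?_
  filter_upwards [extChartAt_source_mem_nhds (I := 𝓘(ℝ, E)) x₀] with y hy
  exact congrArg f ((extChartAt 𝓘(ℝ, E) x₀).left_inv hy).symm

/-- The differential of a function at a point, as a covector. -/
def dAt (f : M → ℝ) (x : M) : E →L[ℝ] ℝ := mfderiv 𝓘(ℝ, E) 𝓘(ℝ, ℝ) f x

lemma fderiv_rep {f : M → ℝ} (hf : ContMDiff 𝓘(ℝ, E) 𝓘(ℝ, ℝ) ∞ f) {x₀ : M} {u : E}
    (hu : u ∈ (extChartAt 𝓘(ℝ, E) x₀).target) :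
    fderiv ℝ (f ∘ (extChartAt 𝓘(ℝ, E) x₀).symm) u =
      (dAt (E := E) f ((extChartAt 𝓘(ℝ, E) x₀).symm u)).comp (dChartSymm x₀ u) := by
  rw [← mfderiv_eq_fderiv, mfderiv_comp u (I' := 𝓘(ℝ, E))]
  · rfl
  · exact hf.mdifferentiableAt (by simp)
  · exact ((contMDiffOn_extChartAt_symm (n := ∞) x₀).contMDiffAt
      ((isOpen_tgt x₀).mem_nhds hu)).mdifferentiableAt (by simp)

lemma dChartSymm_vecRep (X : VF E M) {x₀ : M} {u : E}
    (hu : u ∈ (extChartAt 𝓘(ℝ, E) x₀).target) :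
    dChartSymm x₀ u (vecRep X x₀ u) = X ((extChartAt 𝓘(ℝ, E) x₀).symm u) :=
  dChartSymm_comp hu _

lemma vecRep_self (X : VF E M) (x₀ : M) : vecRep X x₀ (extChartAt 𝓘(ℝ, E) x₀ x₀) = X x₀ := by
  have h : (extChartAt 𝓘(ℝ, E) x₀).symm (extChartAt 𝓘(ℝ, E) x₀ x₀) = x₀ := extChartAt_to_inv x₀
  unfold vecRep
  rw [h, dChart_self]; rfl

/-- The derivative `X f` of a function along a vector field. -/
def lieD (X : VF E M) (f : M → ℝ) (x : M) : ℝ := dAt (E := E) f x (X x)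

lemma lieD_rep (X : VF E M) {f : M → ℝ} (hf : ContMDiff 𝓘(ℝ, E) 𝓘(ℝ, ℝ) ∞ f) {x₀ : M} {u : E}
    (hu : u ∈ (extChartAt 𝓘(ℝ, E) x₀).target) :
    lieD X f ((extChartAt 𝓘(ℝ, E) x₀).symm u) =
      fderiv ℝ (f ∘ (extChartAt 𝓘(ℝ, E) x₀).symm) u (vecRep X x₀ u) := by
  rw [fderiv_rep hf hu, ContinuousLinearMap.comp_apply, dChartSymm_vecRep X hu]; rfl

lemma lieD_self (X : VF E M) {f : M → ℝ} (hf : ContMDiff 𝓘(ℝ, E) 𝓘(ℝ, ℝ) ∞ f) (x₀ : M)  :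
    lieD X f x₀ =
      fderiv ℝ (f ∘ (extChartAt 𝓘(ℝ, E) x₀).symm) (extChartAt 𝓘(ℝ, E) x₀ x₀) (X x₀) := by
  have := lieD_rep X hf (mem_extChartAt_target (I := 𝓘(ℝ, E)) x₀)
  rwa [extChartAt_to_inv x₀, vecRep_self] at this

lemma lieD_smooth (X : VF E M) {f : M → ℝ} (hf : ContMDiff 𝓘(ℝ, E) 𝓘(ℝ, ℝ) ∞ f) :
    ContMDiff 𝓘(ℝ, E) 𝓘(ℝ, ℝ) ∞ (lieD X f) := by
  refine smooth_of_rep fun x₀ => ?_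
  refine ContDiffOn.congr ?_ (fun u hu => lieD_rep X hf hu)
  exact ((rep_smooth hf x₀).fderiv_of_isOpen (isOpen_tgt x₀) (by simp)).clm_apply (vecRep_smooth X x₀)

/-- The Lie bracket of vector fields. -/
def bracket (X Y : VF E M) : VF E M where
  toFun x := VectorField.mlieBracket 𝓘(ℝ, E) X Y x
  contMDiff_toFun := by
    have : IsManifold 𝓘(ℝ, E) (minSmoothness ℝ 2) M := IsManifold.of_le (n := ∞) (by simpa using two_le)
    have : IsManifold 𝓘(ℝ, E) (((⊤ : ℕ∞) : WithTop ℕ∞) + 1) M := by simpa using ‹IsManifold 𝓘(ℝ, E) ∞ M›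
    exact ContDiff.mlieBracket_vectorField (m := ⊤) (n := ⊤) X.contMDiff Y.contMDiff (by simp)

lemma diffAt_vecRep (X : VF E M) (x₀ : M) :
    DifferentiableAt ℝ (vecRep X x₀) (extChartAt 𝓘(ℝ, E) x₀ x₀) :=
  ((vecRep_smooth X x₀).contDiffAt (tgt_nhds x₀)).differentiableAt (by simp)

lemma diffAt_rep {f : M → ℝ} (hf : ContMDiff 𝓘(ℝ, E) 𝓘(ℝ, ℝ) ∞ f) (x₀ : M) :
    DifferentiableAt ℝ (f ∘ (extChartAt 𝓘(ℝ, E) x₀).symm) (extChartAt 𝓘(ℝ, E) x₀ x₀) :=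
  ((rep_smooth hf x₀).contDiffAt (tgt_nhds x₀)).differentiableAt (by simp)

lemma aux_inv (V W : E → E) (u : E) : (ContinuousLinearMap.id ℝ E).inverse
    (VectorField.lieBracketWithin ℝ V W Set.univ u) = VectorField.lieBracket ℝ V W u := by
  simp

lemma bracket_self_pt (X Y : VF E M) (x₀ : M) :
    bracket X Y x₀ = VectorField.lieBracket ℝ (vecRep X x₀) (vecRep Y x₀)
      (extChartAt 𝓘(ℝ, E) x₀ x₀) := by
  change VectorField.mlieBracket 𝓘(ℝ, E) X Y x₀ = _
  rw [← VectorField.mlieBracketWithin_univ, VectorField.mlieBracketWithin_apply]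
  rw [modelWithCornersSelf_coe, Set.range_id, Set.preimage_univ, Set.univ_inter]
  change (dChart x₀ x₀).inverse (VectorField.lieBracketWithin ℝ (E := E)
    (VectorField.mpullbackWithin 𝓘(ℝ, E) 𝓘(ℝ, E) (extChartAt 𝓘(ℝ, E) x₀).symm X Set.univ)
    (VectorField.mpullbackWithin 𝓘(ℝ, E) 𝓘(ℝ, E) (extChartAt 𝓘(ℝ, E) x₀).symm Y Set.univ)
     Set.univ (extChartAt 𝓘(ℝ, E) x₀ x₀)) = _
  rw [dChart_self]
  refine (aux_inv _ _ _).trans ?_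
  simp only [VectorField.mpullbackWithin_univ]
  have h : ∀ X : VF E M, vecRep X x₀ =ᶠ[𝓝 (extChartAt 𝓘(ℝ, E) x₀ x₀)]
     VectorField.mpullback 𝓘(ℝ, E) 𝓘(ℝ, E) (extChartAt 𝓘(ℝ, E) x₀).symm X := fun X => by
    filter_upwards [tgt_nhds x₀] with u hu using vecRep_eq_mpullback X x₀ u hu
  exact ((h X).lieBracket_vectorField_eq (h Y)).symm

lemma lieD_bracket (X Y : VF E M) {f : M → ℝ} (hf : ContMDiff 𝓘(ℝ, E) 𝓘(ℝ, ℝ) ∞ f) (x₀ : M) :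
    lieD (bracket X Y) f x₀ = lieD X (lieD Y f) x₀ - lieD Y (lieD X f) x₀ := by
  rw [lieD_self _ hf, lieD_self _ (lieD_smooth Y hf), lieD_self _ (lieD_smooth X hf), bracket_self_pt]
  have h := VectorField.fderiv_apply_lieBracket (𝕜 := ℝ) (n := ∞) ((rep_smooth hf x₀).contDiffAt (tgt_nhds x₀)) (by simpa using two_le)
    (diffAt_vecRep Y x₀) (diffAt_vecRep X x₀)
  have e : ∀ Z : VF E M, (lieD Z f ∘ (extChartAt 𝓘(ℝ, E) x₀).symm) =ᶠ[𝓝 (extChartAt 𝓘(ℝ, E) x₀ x₀)]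
     fun u => fderiv ℝ (f ∘ (extChartAt 𝓘(ℝ, E) x₀).symm) u (vecRep Z x₀ u) := fun Z => by
    filter_upwards [tgt_nhds x₀] with u hu using lieD_rep Z hf hu
  rw [(e X).fderiv_eq, (e Y).fderiv_eq, h, vecRep_self, vecRep_self]

lemma exists_bump [T2Space M] (x : M) {s : Set M} (hs : s ∈ 𝓝 x) : ∃ ψ : M → ℝ,
    ContMDiff 𝓘(ℝ, E) 𝓘(ℝ, ℝ) ∞ ψ ∧ ψ =ᶠ[𝓝 x] 1 ∧ tsupport ψ ⊆ s := by
  obtain ⟨f, -, hf⟩ := (SmoothBumpFunction.nhds_basis_tsupport (I := 𝓘(ℝ, E)) (c := x)).mem_iff.1 hs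
  exact ⟨f, f.contMDiff, f.eventuallyEq_one, hf⟩

lemma exists_VF [T2Space M] (x : M) (v : E) : ∃ X : VF E M, X x = v := by
  obtain ⟨s, hs, h⟩ := FiberBundle.exists_contMDiffOn_extend 𝓘(ℝ, E) (k := ∞) (F := E)
    (V := (TangentSpace 𝓘(ℝ, E) : M → Type _)) (x₀ := x) v
  obtain ⟨ψ, h1, h2, h3⟩ := exists_bump (E := E) x (interior_mem_nhds.2 hs)
  refine ⟨⟨ψ • FiberBundle.extend E v, ContMDiffOn.smul_section_of_tsupport h1.contMDiffOn isOpen_interior h3 (h.mono interior_subset)⟩, ?_⟩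
  have h4 : (FiberBundle.extend E (E := (TangentSpace 𝓘(ℝ, E) : M → Type _)) (x := x) v x) = v :=
    FiberBundle.extend_apply_self (F := E) (E := (TangentSpace 𝓘(ℝ, E) : M → Type _)) (x := x) v
  have h5 : ψ x = 1 := h2.self_of_nhds
  change ψ x • (FiberBundle.extend E (E := (TangentSpace 𝓘(ℝ, E) : M → Type _)) (x := x) v x) = v
  exact (congrArg₂ (fun (c : ℝ) (w : E) => c • w) h5 h4).trans (one_smul ℝ v)

lemma exists_fun [T2Space M] (x₀ : M) (x : M) (hx : x ∈ (extChartAt 𝓘(ℝ, E) x₀).source) (ℓ : E →L[ℝ] ℝ) :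
   ∃ f : M → ℝ, ContMDiff 𝓘(ℝ, E) 𝓘(ℝ, ℝ) ∞ f ∧ f =ᶠ[𝓝 x] ℓ ∘ extChartAt 𝓘(ℝ, E) x₀ := by
  have hs : (extChartAt 𝓘(ℝ, E) x₀).source ∈ 𝓝 x := (isOpen_extChartAt_source x₀).mem_nhds hx
  obtain ⟨ψ, h1, h2, h3⟩ := exists_bump (E := E) x hs
  refine ⟨fun y => ψ y * ℓ (extChartAt 𝓘(ℝ, E) x₀ y), ?_, ?_⟩
  · refine contMDiff_of_tsupport fun y hy => ?_
    have hy' := h3 (tsupport_mul_subset_left hy)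
    refine h1.contMDiffAt.mul (ℓ.contMDiff.contMDiffAt.comp y ?_)
    exact contMDiffOn_extChartAt.contMDiffAt ((chartAt E x₀).open_source.mem_nhds (by simpa using hy'))
  · filter_upwards [h2] with y hy
    simp [hy]

variable (E M) in
/-- Smooth differential `k`-forms on `M`: fields of alternating `k`-linear forms on the tangent
spaces whose coordinate expressions in all charts are smooth. -/
def Form (k : ℕ) : Submodule ℝ (M → E [⋀^Fin k]→L[ℝ] ℝ) where
  carrier := {a | ∀ x₀ : M, ContDiffOn ℝ ∞ (altRep a x₀) (extChartAt 𝓘(ℝ, E) x₀).target}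
  add_mem' ha hb x₀ := (ha x₀).add (hb x₀)
  zero_mem' _ := contDiffOn_const (c := (0 : E [⋀^Fin k]→L[ℝ] ℝ))
  smul_mem' c _ ha x₀ := (ha x₀).const_smul c

/-- The exterior derivative of a differential form, computed at `x` in the chart centred at `x`. -/
def extD {k : ℕ} (a : M → E [⋀^Fin k]→L[ℝ] ℝ) (x : M) : E [⋀^Fin (k + 1)]→L[ℝ] ℝ :=
  (extDeriv (altRep a x) (extChartAt 𝓘(ℝ, E) x x)).compContinuousLinearMap (dChart x x)

lemma extD_eq {k : ℕ} (a : M → E [⋀^Fin k]→L[ℝ] ℝ) (x : M) :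
    extD a x = extDeriv (altRep a x) (extChartAt 𝓘(ℝ, E) x x) := by
  unfold extD; rw [dChart_self]; ext; rfl

/-- The interior product `ι_X a`, given by `(ι_X a)(v₁, …) = a(X, v₁, …)`. -/
def iota {k : ℕ} (X : VF E M) (a : M → E [⋀^Fin (k + 1)]→L[ℝ] ℝ) (x : M) : E [⋀^Fin k]→L[ℝ] ℝ :=
  (a x).curryLeft (X x)

lemma iota_apply {k : ℕ} (X : VF E M) (a : M → E [⋀^Fin (k + 1)]→L[ℝ] ℝ) (x : M) (v : Fin k → E) :
    iota X a x v = a x (Matrix.vecCons (X x) v) := rfl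

lemma altRep_iota {k : ℕ} (X : VF E M) (a : M → E [⋀^Fin (k + 1)]→L[ℝ] ℝ) (x₀ : M) {u : E}
    (hu : u ∈ (extChartAt 𝓘(ℝ, E) x₀).target) :
    altRep (iota X a) x₀ u = (altRep a x₀ u).curryLeft (vecRep X x₀ u) := by
  ext v
  change a ((extChartAt 𝓘(ℝ, E) x₀).symm u) _ = a ((extChartAt 𝓘(ℝ, E) x₀).symm u) _
  congr 1
  ext i
  refine Fin.cases ?_ (fun i => ?_) i
  · exact (dChartSymm_vecRep X hu).symm
  · rfl

/-- Insertion of a vector in the first slot, as a continuous linear map. -/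
def curryCLM (k : ℕ) : (E [⋀^Fin (k + 1)]→L[ℝ] ℝ) →L[ℝ] (E →L[ℝ] E [⋀^Fin k]→L[ℝ] ℝ) :=
  (ContinuousAlternatingMap.curryLeftLI (𝕜 := ℝ) (E := E) (F := ℝ) (n := k)).toContinuousLinearMap

lemma iota_mem {k : ℕ} (X : VF E M) {a : M → E [⋀^Fin (k + 1)]→L[ℝ] ℝ} (ha : a ∈ Form E M (k + 1)) :
    iota X a ∈ Form E M k := by
  intro x₀
  refine ContDiffOn.congr ?_ (fun u hu => altRep_iota X a x₀ hu)
  exact ((curryCLM (E := E) k).contDiff.comp_contDiffOn (ha x₀)).clm_apply (vecRep_smooth X x₀)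

/-- A `0`-form as a function. -/
def toFun0 (a : M → E [⋀^Fin 0]→L[ℝ] ℝ) (x : M) : ℝ := a x ![]

lemma toFun0_smooth {a : M → E [⋀^Fin 0]→L[ℝ] ℝ} (ha : a ∈ Form E M 0) :
    ContMDiff 𝓘(ℝ, E) 𝓘(ℝ, ℝ) ∞ (toFun0 a) := by
  refine smooth_of_rep fun x₀ => ?_
  refine ContDiffOn.congr ((ContinuousAlternatingMap.apply ℝ E ℝ ![]).contDiff.comp_contDiffOn (ha x₀)) ?_
  intro u hu
  change a _ _ = a _ _
  congr 1
  ext i; exact i.elim0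

lemma ev1_smooth {a : M → E [⋀^Fin 1]→L[ℝ] ℝ} (ha : a ∈ Form E M 1) (X : VF E M) :
    ContMDiff 𝓘(ℝ, E) 𝓘(ℝ, ℝ) ∞ (fun x => a x ![X x]) :=
  toFun0_smooth (iota_mem X ha)

lemma ev3_smooth {a : M → E [⋀^Fin 3]→L[ℝ] ℝ} (ha : a ∈ Form E M 3) (X Y Z : VF E M) :
    ContMDiff 𝓘(ℝ, E) 𝓘(ℝ, ℝ) ∞ (fun x => a x ![X x, Y x, Z x]) :=
  toFun0_smooth (iota_mem Z (iota_mem Y (iota_mem X ha)))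

lemma altRep_apply {k : ℕ} (a : M → E [⋀^Fin k]→L[ℝ] ℝ) (x₀ : M) {u : E}
    (hu : u ∈ (extChartAt 𝓘(ℝ, E) x₀).target) (X : Fin k → VF E M) :
    altRep a x₀ u (fun i => vecRep (X i) x₀ u) = a ((extChartAt 𝓘(ℝ, E) x₀).symm u)
      (fun i => X i ((extChartAt 𝓘(ℝ, E) x₀).symm u)) := by
  change a _ _ = a _ _
  congr 1
  ext i
  exact dChartSymm_vecRep (X i) hu

lemma diffAt_altRep {k : ℕ} {a : M → E [⋀^Fin k]→L[ℝ] ℝ} (ha : a ∈ Form E M k) (x₀ : M) :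
    DifferentiableAt ℝ (altRep a x₀) (extChartAt 𝓘(ℝ, E) x₀ x₀) :=
  ((ha x₀).contDiffAt (tgt_nhds x₀)).differentiableAt (by simp)

lemma altRep_self {k : ℕ} (a : M → E [⋀^Fin k]→L[ℝ] ℝ) (x₀ : M) :
    altRep a x₀ (extChartAt 𝓘(ℝ, E) x₀ x₀) = a x₀ := by
  have h : (extChartAt 𝓘(ℝ, E) x₀).symm (extChartAt 𝓘(ℝ, E) x₀ x₀) = x₀ := extChartAt_to_inv x₀
  unfold altRep
  rw [h, dChartSymm_self]; ext; rfl

lemma koszul {k : ℕ} {a : M → E [⋀^Fin (k + 1)]→L[ℝ] ℝ} (ha : a ∈ Form E M (k + 1))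
    (hs : ∀ X : Fin (k + 1) → VF E M,
      ContMDiff 𝓘(ℝ, E) 𝓘(ℝ, ℝ) ∞ (fun x => a x (fun i => X i x)))
    (X : Fin (k + 2) → VF E M) (x : M) :
    extD a x (fun i => X i x) =
     (∑ i, (-1 : ℤ) ^ i.val • lieD (X i) (fun y => a y (fun j => i.removeNth X j y)) x) -
        ∑ i : Fin (k + 1), ∑ j ≥ i,
          (-1 : ℤ) ^ (i + j : ℕ) •
            a x (Matrix.vecCons (bracket (X i.castSucc) (X j.succ) x)
              (fun l => (j.removeNth <| i.castSucc.removeNth X) l x)) := by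
  have h := extDeriv_apply_vectorField (V := fun i => vecRep (X i) x) (diffAt_altRep ha x)
    (fun i => diffAt_vecRep (X i) x)
  rw [extD_eq]
  simp only [vecRep_self, altRep_self] at h
  rw [h]
  congr 1
  · refine Finset.sum_congr rfl fun i _ => ?_
    rw [lieD_self _ (hs _)]
    congr 2
    apply Filter.EventuallyEq.fderiv_eq
    filter_upwards [tgt_nhds x] with u hu
    exact altRep_apply a x hu (i.removeNth X)
  · refine Finset.sum_congr rfl fun i _ => Finset.sum_congr rfl fun j _ => ?_
    congr 2
    rw [bracket_self_pt]; rfl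

lemma vec1 (f : Fin 1 → E) : f = ![f 0] := by ext i; fin_cases i; rfl
lemma vec2 (f : Fin 2 → E) : f = ![f 0, f 1] := by ext i; fin_cases i <;> rfl
lemma vec3 (f : Fin 3 → E) : f = ![f 0, f 1, f 2] := by ext i; fin_cases i <;> rfl
lemma vec4 (f : Fin 4 → E) : f = ![f 0, f 1, f 2, f 3] := by ext i; fin_cases i <;> rfl

lemma extD_one {a : M → E [⋀^Fin 1]→L[ℝ] ℝ} (ha : a ∈ Form E M 1) (X Y : VF E M) (x : M) :
    extD a x ![X x, Y x] = lieD X (fun y => a y ![Y y]) x - lieD Y (fun y => a y ![X y]) x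
      - a x ![bracket X Y x] := by
  have h := koszul ha (fun X => by
    have : (fun x => a x (fun i => X i x)) = (fun x => a x ![X 0 x]) :=
      funext fun y => congrArg (a y) (vec1 (E := E) _)
    rw [this]
    exact ev1_smooth ha (X 0)) ![X, Y] x
  rw [Fin.sum_univ_two, Fin.sum_univ_one, show Finset.Ici (0 : Fin 1) = {0} from by decide,
    Finset.sum_singleton] at h
  refine (congrArg (extD a x) (vec2 (E := E) _)).symm.trans (h.trans ?_)
  have e0 : (fun y => a y (fun j => (0 : Fin 2).removeNth ![X, Y] j y)) = fun y => a y ![Y y] :=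
    funext fun y => congrArg (a y) (vec1 (E := E) _)
  have e1 : (fun y => a y (fun j => (1 : Fin 2).removeNth ![X, Y] j y)) = fun y => a y ![X y] :=
    funext fun y => congrArg (a y) (vec1 (E := E) _)
  rw [e0, e1]
  change (-1 : ℤ) ^ 0 • lieD X (fun y => a y ![Y y]) x + (-1 : ℤ) ^ 1 • lieD Y (fun y => a y ![X y]) x
    - (-1 : ℤ) ^ 0 • _ = _
  rw [show a x _ = a x ![bracket X Y x] from congrArg (a x) (vec1 (E := E) _)]
  simp; ring

lemma extD_three {a : M → E [⋀^Fin 3]→L[ℝ] ℝ} (ha : a ∈ Form E M 3) (X Y Z W : VF E M) (x : M) :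
    extD a x ![X x, Y x, Z x, W x] = lieD X (fun y => a y ![Y y, Z y, W y]) x
      - lieD Y (fun y => a y ![X y, Z y, W y]) x
      + lieD Z (fun y => a y ![X y, Y y, W y]) x
      - lieD W (fun y => a y ![X y, Y y, Z y]) x
      - a x ![bracket X Y x, Z x, W x] + a x ![bracket X Z x, Y x, W x]
      - a x ![bracket X W x, Y x, Z x] - a x ![bracket Y Z x, X x, W x]
      + a x ![bracket Y W x, X x, Z x] - a x ![bracket Z W x, X x, Y x] := by
  have h := koszul ha (fun X => by
    have : (fun x => a x (fun i => X i x)) = (fun x => a x ![X 0 x, X 1 x, X 2 x]) :=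
      funext fun y => congrArg (a y) (vec3 (E := E) _)
    rw [this]
    exact ev3_smooth ha (X 0) (X 1) (X 2)) ![X, Y, Z, W] x
  have I0 : Finset.Ici (0 : Fin 3) = {0, 1, 2} := by decide
  have I1 : Finset.Ici (1 : Fin 3) = {1, 2} := by decide
  have I2 : Finset.Ici (2 : Fin 3) = {2} := by decide
  rw [Fin.sum_univ_four, Fin.sum_univ_three, I0, I1, I2,
    Finset.sum_insert (by decide), Finset.sum_insert (by decide), Finset.sum_insert (by decide),
    Finset.sum_singleton, Finset.sum_singleton, Finset.sum_singleton] at h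
  refine (congrArg (extD a x) (vec4 (E := E) _)).symm.trans (h.trans ?_)
  have e0 : (fun y => a y (fun j => (0 : Fin 4).removeNth ![X, Y, Z, W] j y)) =
      fun y => a y ![Y y, Z y, W y] :=
    funext fun y => congrArg (a y) (vec3 (E := E) _)
  have e1 : (fun y => a y (fun j => (1 : Fin 4).removeNth ![X, Y, Z, W] j y)) =
      fun y => a y ![X y, Z y, W y] :=
    funext fun y => congrArg (a y) (vec3 (E := E) _)
  have e2 : (fun y => a y (fun j => (2 : Fin 4).removeNth ![X, Y, Z, W] j y)) =
      fun y => a y ![X y, Y y, W y] :=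
    funext fun y => congrArg (a y) (vec3 (E := E) _)
  have e3 : (fun y => a y (fun j => (3 : Fin 4).removeNth ![X, Y, Z, W] j y)) =
      fun y => a y ![X y, Y y, Z y] :=
    funext fun y => congrArg (a y) (vec3 (E := E) _)
  rw [e0, e1, e2, e3]
  have f00 : a x (Matrix.vecCons (bracket (![X, Y, Z, W] (0 : Fin 3).castSucc) (![X, Y, Z, W] (0 : Fin 3).succ) x)
      (fun l => ((0 : Fin 3).removeNth <| (0 : Fin 3).castSucc.removeNth ![X, Y, Z, W]) l x)) =
      a x ![bracket X Y x, Z x, W x] := congrArg (a x) (vec3 (E := E) _)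
  have f01 : a x (Matrix.vecCons (bracket (![X, Y, Z, W] (0 : Fin 3).castSucc) (![X, Y, Z, W] (1 : Fin 3).succ) x)
      (fun l => ((1 : Fin 3).removeNth <| (0 : Fin 3).castSucc.removeNth ![X, Y, Z, W]) l x)) =
      a x ![bracket X Z x, Y x, W x] := congrArg (a x) (vec3 (E := E) _)
  have f02 : a x (Matrix.vecCons (bracket (![X, Y, Z, W] (0 : Fin 3).castSucc) (![X, Y, Z, W] (2 : Fin 3).succ) x)
      (fun l => ((2 : Fin 3).removeNth <| (0 : Fin 3).castSucc.removeNth ![X, Y, Z, W]) l x)) =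
      a x ![bracket X W x, Y x, Z x] := congrArg (a x) (vec3 (E := E) _)
  have f11 : a x (Matrix.vecCons (bracket (![X, Y, Z, W] (1 : Fin 3).castSucc) (![X, Y, Z, W] (1 : Fin 3).succ) x)
      (fun l => ((1 : Fin 3).removeNth <| (1 : Fin 3).castSucc.removeNth ![X, Y, Z, W]) l x)) =
      a x ![bracket Y Z x, X x, W x] := congrArg (a x) (vec3 (E := E) _)
  have f12 : a x (Matrix.vecCons (bracket (![X, Y, Z, W] (1 : Fin 3).castSucc) (![X, Y, Z, W] (2 : Fin 3).succ) x)
      (fun l => ((2 : Fin 3).removeNth <| (1 : Fin 3).castSucc.removeNth ![X, Y, Z, W]) l x)) =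
      a x ![bracket Y W x, X x, Z x] := congrArg (a x) (vec3 (E := E) _)
  have f22 : a x (Matrix.vecCons (bracket (![X, Y, Z, W] (2 : Fin 3).castSucc) (![X, Y, Z, W] (2 : Fin 3).succ) x)
      (fun l => ((2 : Fin 3).removeNth <| (2 : Fin 3).castSucc.removeNth ![X, Y, Z, W]) l x)) =
      a x ![bracket Z W x, X x, Y x] := congrArg (a x) (vec3 (E := E) _)
  rw [f00, f01, f02, f11, f12, f22]
  change (-1 : ℤ) ^ 0 • lieD X _ x + (-1 : ℤ) ^ 1 • lieD Y _ x + (-1 : ℤ) ^ 2 • lieD Z _ x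
    + (-1 : ℤ) ^ 3 • lieD W _ x - ((-1 : ℤ) ^ 0 • _ + ((-1 : ℤ) ^ 1 • _ + (-1 : ℤ) ^ 2 • _) +
    ((-1 : ℤ) ^ 2 • _ + (-1 : ℤ) ^ 3 • _) + (-1 : ℤ) ^ 4 • _) = _
  have h3 : (-1 : ℤ) ^ 3 = -1 := by norm_num
  have h4 : (-1 : ℤ) ^ 4 = 1 := by norm_num
  have h2 : (-1 : ℤ) ^ 2 = 1 := by norm_num
  simp only [h2, h3, h4, pow_zero, pow_one, one_smul, neg_smul]
  ring

lemma ext_dual {v w : E} (h : ∀ ℓ : E →L[ℝ] ℝ, ℓ v = ℓ w) : v = w := by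
  by_contra hne
  obtain ⟨ℓ, hℓ⟩ := SeparatingDual.exists_separating_of_ne (R := ℝ) hne
  exact hℓ (h ℓ)

lemma dAt_add {f g : M → ℝ} (hf : ContMDiff 𝓘(ℝ, E) 𝓘(ℝ, ℝ) ∞ f)
    (hg : ContMDiff 𝓘(ℝ, E) 𝓘(ℝ, ℝ) ∞ g) (x : M) :
    dAt (E := E) (f + g) x = dAt (E := E) f x + dAt (E := E) g x :=
  mfderiv_add (hf.mdifferentiableAt (by simp)) (hg.mdifferentiableAt (by simp))

lemma dAt_smul {f : M → ℝ} (hf : ContMDiff 𝓘(ℝ, E) 𝓘(ℝ, ℝ) ∞ f) (c : ℝ) (x : M) :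
    dAt (E := E) (c • f) x = c • dAt (E := E) f x :=
  const_smul_mfderiv (hf.mdifferentiableAt (by simp)) c

lemma lieD_add (X : VF E M) {f g : M → ℝ} (hf : ContMDiff 𝓘(ℝ, E) 𝓘(ℝ, ℝ) ∞ f)
    (hg : ContMDiff 𝓘(ℝ, E) 𝓘(ℝ, ℝ) ∞ g) (x : M) :
    lieD X (f + g) x = lieD X f x + lieD X g x := by
  unfold lieD; rw [dAt_add hf hg]; rfl

lemma lieD_smul (X : VF E M) {f : M → ℝ} (hf : ContMDiff 𝓘(ℝ, E) 𝓘(ℝ, ℝ) ∞ f) (c : ℝ) (x : M) :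
    lieD X (c • f) x = c * lieD X f x := by
  unfold lieD; rw [dAt_smul hf]; rfl

lemma lieD_neg (X : VF E M) {f : M → ℝ} (hf : ContMDiff 𝓘(ℝ, E) 𝓘(ℝ, ℝ) ∞ f) (x : M) :
    lieD X (-f) x = - lieD X f x := by
  have := lieD_smul X hf (-1) x
  simpa using this

lemma lieD_sub (X : VF E M) {f g : M → ℝ} (hf : ContMDiff 𝓘(ℝ, E) 𝓘(ℝ, ℝ) ∞ f)
    (hg : ContMDiff 𝓘(ℝ, E) 𝓘(ℝ, ℝ) ∞ g) (x : M) :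
    lieD X (f - g) x = lieD X f x - lieD X g x := by
  rw [sub_eq_add_neg, lieD_add X hf (g := -g) hg.neg, lieD_neg X hg]; ring

lemma lieD_VF_add (X Y : VF E M) (f : M → ℝ) (x : M) :
    lieD (X + Y) f x = lieD X f x + lieD Y f x :=
  (dAt (E := E) f x).map_add (X x) (Y x)

lemma lieD_VF_smul (c : ℝ) (X : VF E M) (f : M → ℝ) (x : M) :
    lieD (c • X) f x = c * lieD X f x :=
  (dAt (E := E) f x).map_smul c (X x)

lemma lieD_VF_neg (X : VF E M) (f : M → ℝ) (x : M) :
    lieD (-X) f x = - lieD X f x :=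
  (dAt (E := E) f x).map_neg (X x)

/-- The differential `df` of a function, as a `1`-form. -/
def dFun (f : M → ℝ) (x : M) : E [⋀^Fin 1]→L[ℝ] ℝ :=
  ContinuousAlternatingMap.ofSubsingletonLIE (𝕜 := ℝ) (E := E) (F := ℝ) (0 : Fin 1) (dAt f x)

lemma dFun_apply (f : M → ℝ) (x : M) (v : E) : dFun f x ![v] = dAt (E := E) f x v := rfl

lemma dFun_mem {f : M → ℝ} (hf : ContMDiff 𝓘(ℝ, E) 𝓘(ℝ, ℝ) ∞ f) : dFun f ∈ Form E M 1 := by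
  intro x₀
  refine ContDiffOn.congr ((ContinuousAlternatingMap.ofSubsingletonLIE (𝕜 := ℝ) (E := E) (F := ℝ) (0 : Fin 1)).contDiff.comp_contDiffOn
    ((rep_smooth hf x₀).fderiv_of_isOpen (isOpen_tgt x₀) (m := ∞) (by simp))) ?_
  intro u hu
  rw [Function.comp_apply, fderiv_rep hf hu]
  rfl

lemma dFun_add {f g : M → ℝ} (hf : ContMDiff 𝓘(ℝ, E) 𝓘(ℝ, ℝ) ∞ f)
    (hg : ContMDiff 𝓘(ℝ, E) 𝓘(ℝ, ℝ) ∞ g) : dFun (E := E) (f + g) = dFun f + dFun g := by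
  funext x; unfold dFun; rw [dAt_add hf hg, map_add]; rfl

lemma dFun_smul {f : M → ℝ} (hf : ContMDiff 𝓘(ℝ, E) 𝓘(ℝ, ℝ) ∞ f) (c : ℝ) :
    dFun (E := E) (c • f) = c • dFun f := by
  funext x; unfold dFun; rw [dAt_smul hf, map_smul]; rfl

lemma extD_add {k : ℕ} {a b : M → E [⋀^Fin k]→L[ℝ] ℝ} (ha : a ∈ Form E M k) (hb : b ∈ Form E M k)
    (x : M) : extD (a + b) x = extD a x + extD b x := by
  rw [extD_eq, extD_eq, extD_eq]
  exact extDeriv_add (diffAt_altRep ha x) (diffAt_altRep hb x)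

lemma extD_smul {k : ℕ} (c : ℝ) (a : M → E [⋀^Fin k]→L[ℝ] ℝ)
    (x : M) : extD (c • a) x = c • extD a x := by
  rw [extD_eq, extD_eq]
  exact extDeriv_smul c (altRep a x)

section
variable [T2Space M]

lemma ext1 {x : M} {a b : E [⋀^Fin 1]→L[ℝ] ℝ} (h : ∀ X : VF E M, (a : E [⋀^Fin 1]→L[ℝ] ℝ) ![X x] = b ![X x]) : a = b := by
  ext v
  obtain ⟨X, hX⟩ := exists_VF (E := E) x (v 0)
  have hv : v = ![X x] := by rw [hX]; exact vec1 v
  rw [hv]; exact h X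

lemma ext2 {x : M} {a b : E [⋀^Fin 2]→L[ℝ] ℝ} (h : ∀ X Y : VF E M, a ![X x, Y x] = b ![X x, Y x]) :
    a = b := by
  ext v
  obtain ⟨X, hX⟩ := exists_VF (E := E) x (v 0)
  obtain ⟨Y, hY⟩ := exists_VF (E := E) x (v 1)
  have hv : v = ![X x, Y x] := by rw [hX, hY]; exact vec2 v
  rw [hv]; exact h X Y

lemma extD_dFun {f : M → ℝ} (hf : ContMDiff 𝓘(ℝ, E) 𝓘(ℝ, ℝ) ∞ f) (x : M) :
    extD (dFun (E := E) f) x = 0 := by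
  refine ext2 (x := x) fun X Y => ?_
  rw [extD_one (dFun_mem hf)]
  exact sub_eq_zero.2 (lieD_bracket X Y hf x).symm

lemma VF_ext {X Y : VF E M} (h : ∀ f : M → ℝ, ContMDiff 𝓘(ℝ, E) 𝓘(ℝ, ℝ) ∞ f → ∀ x, lieD X f x = lieD Y f x) :
    X = Y := by
  ext x
  refine ext_dual (E := E) ?_
  intro ℓ
  obtain ⟨f, hf, hf'⟩ := exists_fun (E := E) x x (mem_extChartAt_source x) ℓ
  have h1 := h f hf x
  rw [lieD_self _ hf, lieD_self _ hf] at h1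
  have h2 : (f ∘ (extChartAt 𝓘(ℝ, E) x).symm) =ᶠ[𝓝 (extChartAt 𝓘(ℝ, E) x x)] ℓ := by
    have h3 : Filter.Tendsto (extChartAt 𝓘(ℝ, E) x).symm (𝓝 (extChartAt 𝓘(ℝ, E) x x)) (𝓝 x) := by
      have := continuousAt_extChartAt_symm (I := 𝓘(ℝ, E)) x
      rwa [ContinuousAt, extChartAt_to_inv] at this
    filter_upwards [h3.eventually hf', tgt_nhds x] with u hu hu'
    simp only [Function.comp_apply, hu, (extChartAt 𝓘(ℝ, E) x).right_inv hu']
  rw [h2.fderiv_eq, ℓ.fderiv] at h1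
  exact h1
end

lemma alt3_swap01 (a : E [⋀^Fin 3]→L[ℝ] ℝ) (u v w : E) : a ![u, v, w] = - a ![v, u, w] := by
  have := a.toAlternatingMap.map_swap ![v, u, w] (i := 0) (j := 1) (by decide)
  rw [← show ![u, v, w] = ![v, u, w] ∘ (Equiv.swap (0 : Fin 3) 1) from by
    ext i; fin_cases i <;> rfl] at this
  exact this

lemma alt3_swap12 (a : E [⋀^Fin 3]→L[ℝ] ℝ) (u v w : E) : a ![u, v, w] = - a ![u, w, v] := by
  have := a.toAlternatingMap.map_swap ![u, w, v] (i := 1) (j := 2) (by decide)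
  rw [← show ![u, v, w] = ![u, w, v] ∘ (Equiv.swap (1 : Fin 3) 2) from by
    ext i; fin_cases i <;> rfl] at this
  exact this

lemma alt2_swap (a : E [⋀^Fin 2]→L[ℝ] ℝ) (u v : E) : a ![u, v] = - a ![v, u] := by
  have := a.toAlternatingMap.map_swap ![v, u] (i := 0) (j := 1) (by decide)
  rw [← show ![u, v] = ![v, u] ∘ (Equiv.swap (0 : Fin 2) 1) from by
    ext i; fin_cases i <;> rfl] at this
  exact this

lemma alt_cons_add {k : ℕ} (a : E [⋀^Fin (k + 1)]→L[ℝ] ℝ) (u v : E) (w : Fin k → E) :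
    a (Matrix.vecCons (u + v) w) = a (Matrix.vecCons u w) + a (Matrix.vecCons v w) :=
  a.toAlternatingMap.map_vecCons_add w u v

lemma alt_cons_smul {k : ℕ} (a : E [⋀^Fin (k + 1)]→L[ℝ] ℝ) (c : ℝ) (v : E) (w : Fin k → E) :
    a (Matrix.vecCons (c • v) w) = c * a (Matrix.vecCons v w) :=
  a.toAlternatingMap.map_vecCons_smul w c v

lemma alt_cons_neg {k : ℕ} (a : E [⋀^Fin (k + 1)]→L[ℝ] ℝ) (v : E) (w : Fin k → E) :
    a (Matrix.vecCons (-v) w) = - a (Matrix.vecCons v w) := by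
  have := alt_cons_smul a (-1) v w
  simpa using this

/-- The function `a(A)`. -/
def ev1 (a : M → E [⋀^Fin 1]→L[ℝ] ℝ) (A : VF E M) (x : M) : ℝ := a x ![A x]
/-- The function `a(A, B, C)`. -/
def ev3 (a : M → E [⋀^Fin 3]→L[ℝ] ℝ) (A B C : VF E M) (x : M) : ℝ := a x ![A x, B x, C x]

lemma ev3_swap01 (a : M → E [⋀^Fin 3]→L[ℝ] ℝ) (A B C : VF E M) :
    ev3 a A B C = - ev3 a B A C := funext fun x => alt3_swap01 (E := E) (a x) (A x : E) (B x : E) (C x : E)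
lemma ev3_swap12 (a : M → E [⋀^Fin 3]→L[ℝ] ℝ) (A B C : VF E M) :
    ev3 a A B C = - ev3 a A C B := funext fun x => alt3_swap12 (E := E) (a x) (A x : E) (B x : E) (C x : E)
lemma ev3_rot (a : M → E [⋀^Fin 3]→L[ℝ] ℝ) (A B C : VF E M) :
    ev3 a A B C = ev3 a B C A := by
  rw [ev3_swap01, ev3_swap12 a B A C, neg_neg]
lemma ev3_add (a : M → E [⋀^Fin 3]→L[ℝ] ℝ) (A A' B C : VF E M) :
    ev3 a (A + A') B C = ev3 a A B C + ev3 a A' B C :=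
  funext fun x => alt_cons_add (E := E) (a x) (A x : E) (A' x : E) ![(B x : E), C x]
lemma ev3_smul (a : M → E [⋀^Fin 3]→L[ℝ] ℝ) (c : ℝ) (A B C : VF E M) :
    ev3 a (c • A) B C = c • ev3 a A B C :=
  funext fun x => alt_cons_smul (E := E) (a x) c (A x : E) ![(B x : E), C x]
lemma ev3_neg (a : M → E [⋀^Fin 3]→L[ℝ] ℝ) (A B C : VF E M) :
    ev3 a (-A) B C = - ev3 a A B C :=
  funext fun x => alt_cons_neg (E := E) (a x) (A x : E) ![(B x : E), C x]
lemma ev1_add_right (a : M → E [⋀^Fin 1]→L[ℝ] ℝ) (A A' : VF E M) :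
    ev1 a (A + A') = ev1 a A + ev1 a A' :=
  funext fun x => alt_cons_add (E := E) (a x) (A x : E) (A' x : E) ![]
lemma ev1_neg_right (a : M → E [⋀^Fin 1]→L[ℝ] ℝ) (A : VF E M) :
    ev1 a (-A) = - ev1 a A :=
  funext fun x => alt_cons_neg (E := E) (a x) (A x : E) ![]

lemma ev3_self (a : M → E [⋀^Fin 3]→L[ℝ] ℝ) (A B : VF E M) : ev3 a A A B = 0 := by
  have h := ev3_swap01 a A A B
  funext x
  have := congrFun h x
  simp only [Pi.neg_apply] at this
  simp only [Pi.zero_apply]; linarith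

section
variable [T2Space M]

lemma bracket_swap (A B : VF E M) : bracket A B = - bracket B A := by
  refine VF_ext fun f hf x => ?_
  rw [lieD_VF_neg, lieD_bracket _ _ hf, lieD_bracket _ _ hf]; ring

lemma bracket_add_left (A B C : VF E M) : bracket (A + B) C = bracket A C + bracket B C := by
  refine VF_ext fun f hf x => ?_
  have e : lieD (A + B) f = lieD A f + lieD B f := funext fun y => lieD_VF_add A B f y
  rw [lieD_VF_add, lieD_bracket _ _ hf, lieD_bracket _ _ hf, lieD_bracket _ _ hf, lieD_VF_add, e,
    lieD_add _ (lieD_smooth _ hf) (lieD_smooth _ hf)]; ring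

lemma bracket_smul_left (c : ℝ) (A C : VF E M) : bracket (c • A) C = c • bracket A C := by
  refine VF_ext fun f hf x => ?_
  have e : lieD (c • A) f = c • lieD A f := funext fun y => lieD_VF_smul c A f y
  rw [lieD_VF_smul, lieD_bracket _ _ hf, lieD_bracket _ _ hf, lieD_VF_smul, e,
    lieD_smul _ (lieD_smooth _ hf)]; ring

lemma bracket_add_right (A B C : VF E M) : bracket A (B + C) = bracket A B + bracket A C := by
  rw [bracket_swap, bracket_add_left, bracket_swap A B, bracket_swap A C, neg_add]

lemma bracket_smul_right (c : ℝ) (A C : VF E M) : bracket A (c • C) = c • bracket A C := by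
  rw [bracket_swap, bracket_smul_left, bracket_swap A C, smul_neg]

lemma bracket_neg_left (A C : VF E M) : bracket (-A) C = -bracket A C := by
  have := bracket_smul_left (-1) A C
  simpa using this

lemma bracket_neg_right (A C : VF E M) : bracket A (-C) = -bracket A C := by
  have := bracket_smul_right (-1) A C
  simpa using this

lemma bracket_self (A : VF E M) : bracket A A = 0 := by
  have h := bracket_swap A A
  have h2 : (2 : ℝ) • bracket A A = 0 := by rw [two_smul]; nth_rw 2 [h]; abel
  simpa using h2

lemma bracket_jacobi (A B C : VF E M) :
    bracket A (bracket B C) = bracket (bracket A B) C + bracket B (bracket A C) := by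
  refine VF_ext fun f hf x => ?_
  have e : ∀ A B : VF E M, lieD (bracket A B) f = lieD A (lieD B f) - lieD B (lieD A f) :=
    fun A B => funext fun y => lieD_bracket A B hf y
  have s : ∀ A B : VF E M, ContMDiff 𝓘(ℝ, E) 𝓘(ℝ, ℝ) ∞ (lieD A (lieD B f)) :=
    fun A B => lieD_smooth A (lieD_smooth B hf)
  rw [lieD_VF_add]
  simp only [e, lieD_bracket _ _ hf, lieD_bracket _ _ (lieD_smooth _ hf), lieD_sub _ (s _ _) (s _ _)]
  ring
end

/-- `X` is a Hamiltonian vector field of the `1`-form `α`: `dα = -ι_X Ω`. -/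
def IsHamiltonianFor (Ω : M → E [⋀^Fin 3]→L[ℝ] ℝ) (α : M → E [⋀^Fin 1]→L[ℝ] ℝ) (X : VF E M) : Prop :=
  ∀ x, extD α x = - iota X Ω x

lemma ham_eq {Ω : M → E [⋀^Fin 3]→L[ℝ] ℝ} {α : M → E [⋀^Fin 1]→L[ℝ] ℝ} (hα : α ∈ Form E M 1) {X : VF E M}
    (h : IsHamiltonianFor Ω α X) (A B : VF E M) (x : M) :
    lieD A (ev1 α B) x - lieD B (ev1 α A) x - ev1 α (bracket A B) x = - ev3 Ω X A B x := by
  rw [show ev1 α = fun A x => α x ![A x] from rfl]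
  refine (extD_one hα A B x).symm.trans ?_
  rw [h x]; rfl

section
variable [T2Space M]

lemma lieD_ev3_of_ham {Ω : M → E [⋀^Fin 3]→L[ℝ] ℝ} (hΩ : Ω ∈ Form E M 3) (hd : ∀ x, extD Ω x = 0)
    {α : M → E [⋀^Fin 1]→L[ℝ] ℝ} (hα : α ∈ Form E M 1) {X : VF E M}
    (h : IsHamiltonianFor Ω α X) (A B C : VF E M) (x : M) :
    lieD X (ev3 Ω A B C) x = ev3 Ω (bracket X A) B C x + ev3 Ω A (bracket X B) C x
     + ev3 Ω A B (bracket X C) x := by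
  have h1 : extD Ω x ![X x, A x, B x, C x] = 0 := by rw [hd x]; rfl
  rw [extD_three hΩ] at h1
  change lieD X (ev3 Ω A B C) x - lieD A (ev3 Ω X B C) x + lieD B (ev3 Ω X A C) x -
    lieD C (ev3 Ω X A B) x - ev3 Ω (bracket X A) B C x + ev3 Ω (bracket X B) A C x
    - ev3 Ω (bracket X C) A B x - ev3 Ω (bracket A B) X C x + ev3 Ω (bracket A C) X B x
    - ev3 Ω (bracket B C) X A x = 0 at h1
  have s1 : ∀ A : VF E M, ContMDiff 𝓘(ℝ, E) 𝓘(ℝ, ℝ) ∞ (ev1 α A) := fun A => ev1_smooth hα A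
  have e : ∀ A B : VF E M, ev3 Ω X A B =
    ev1 α (bracket A B) - (lieD A (ev1 α B) - lieD B (ev1 α A)) := fun A B => by
    funext y; have := ham_eq hα h A B y
    simp only [Pi.sub_apply]; linarith
  have r : ∀ A B D : VF E M, ev3 Ω (bracket A B) X D x = - ev3 Ω X (bracket A B) D x := fun A B D =>
    congrFun (ev3_swap01 Ω _ _ _) x
  have r1 : ∀ D : VF E M, ev3 Ω D A C x = - ev3 Ω A D C x := fun D => congrFun (ev3_swap01 Ω _ _ _) x
  have r2 : ∀ D : VF E M, ev3 Ω D A B x = ev3 Ω A B D x := fun D => congrFun (ev3_rot Ω _ _ _) x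
  have j := congrFun (congrArg (ev1 α) (bracket_jacobi A B C)) x
  rw [ev1_add_right, bracket_swap (bracket A B) C, bracket_swap B (bracket A C), ev1_neg_right,
    ev1_neg_right] at j
  have j2 := bracket_swap C (bracket A B)
  simp only [r, r1, r2, e] at h1
  have s2 : ∀ A B : VF E M, ContMDiff 𝓘(ℝ, E) 𝓘(ℝ, ℝ) ∞ (lieD A (ev1 α B)) :=
    fun A B => lieD_smooth A (s1 B)
  have s3 : ∀ A B : VF E M, ContMDiff 𝓘(ℝ, E) 𝓘(ℝ, ℝ) ∞ (lieD A (ev1 α B) - lieD B (ev1 α A)) :=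
    fun A B => (s2 A B).sub (s2 B A)
  simp only [lieD_sub _ (s1 _) (s3 _ _), lieD_sub _ (s2 _ _) (s2 _ _), Pi.sub_apply,
     lieD_bracket _ _ (s1 _)] at h1
  simp only [Pi.add_apply, Pi.neg_apply] at j
  have j3 := congrFun (congrArg (ev1 α) (bracket_swap C (bracket A B))) x
  have j4 := congrFun (congrArg (ev1 α) (bracket_swap B (bracket A C))) x
  have j5 := congrFun (congrArg (ev1 α) (bracket_swap A (bracket B C))) x
  rw [ev1_neg_right] at j3 j4 j5
  simp only [Pi.neg_apply] at j3 j4 j5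
  linarith

lemma isHamiltonianFor_bracket {Ω : M → E [⋀^Fin 3]→L[ℝ] ℝ} (hΩ : Ω ∈ Form E M 3) (hd : ∀ x, extD Ω x = 0)
    {α β : M → E [⋀^Fin 1]→L[ℝ] ℝ} (hα : α ∈ Form E M 1) (hβ : β ∈ Form E M 1) {X Y : VF E M}
    (h : IsHamiltonianFor Ω α X) (h' : IsHamiltonianFor Ω β Y) : IsHamiltonianFor Ω (iota Y (iota X Ω)) (bracket X Y) := by
  intro x
  refine ext2 (x := x) fun A B => ?_
  rw [extD_one (iota_mem Y (iota_mem X hΩ))]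
  change lieD A (ev3 Ω X Y B) x - lieD B (ev3 Ω X Y A) x - ev3 Ω X Y (bracket A B) x =
    - ev3 Ω (bracket X Y) A B x
  have h1 : extD Ω x ![X x, Y x, A x, B x] = 0 := by rw [hd x]; rfl
  rw [extD_three hΩ] at h1
  change lieD X (ev3 Ω Y A B) x - lieD Y (ev3 Ω X A B) x + lieD A (ev3 Ω X Y B) x -
    lieD B (ev3 Ω X Y A) x - ev3 Ω (bracket X Y) A B x + ev3 Ω (bracket X A) Y B x
    - ev3 Ω (bracket X B) Y A x - ev3 Ω (bracket Y A) X B x + ev3 Ω (bracket Y B) X A x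
    - ev3 Ω (bracket A B) X Y x = 0 at h1
  have p := lieD_ev3_of_ham hΩ hd hα h Y A B x
  have q := lieD_ev3_of_ham hΩ hd hβ h' X A B x
  have r1 := congrFun (ev3_rot Ω (bracket A B) X Y) x
  have r2 : ∀ D B : VF E M, ev3 Ω D Y B x = - ev3 Ω Y D B x := fun D B => congrFun (ev3_swap01 Ω _ _ _) x
  have r3 : ∀ D B : VF E M, ev3 Ω D X B x = - ev3 Ω X D B x := fun D B => congrFun (ev3_swap01 Ω _ _ _) x
  have r4 : ∀ A D B : VF E M, ev3 Ω A D B x = - ev3 Ω A B D x := fun A D B => congrFun (ev3_swap12 Ω _ _ _) x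
  rw [r4 Y A] at p
  rw [r4 X A] at q
  rw [bracket_swap Y X, ev3_neg, Pi.neg_apply] at q
  rw [r2, r2, r3, r3, r1] at h1
  have := r4 Y A (bracket X B)
  have := r4 X A (bracket Y B)
  have := r4 Y (bracket X B) A
  have := r4 X (bracket Y B) A
  have := r4 Y (bracket X A) B
  have := r4 X (bracket Y A) B
  linarith
end

section
variable [T2Space M]
lemma lieD_ev3_ham {Ω : M → E [⋀^Fin 3]→L[ℝ] ℝ} (hΩ : Ω ∈ Form E M 3) (hd : ∀ x, extD Ω x = 0)
    {α β γ : M → E [⋀^Fin 1]→L[ℝ] ℝ} (hα : α ∈ Form E M 1) (hβ : β ∈ Form E M 1)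
    (hγ : γ ∈ Form E M 1) {X Y Z : VF E M}
    (h : IsHamiltonianFor Ω α X) (h' : IsHamiltonianFor Ω β Y) (h'' : IsHamiltonianFor Ω γ Z) (W : VF E M) (x : M) :
    lieD W (ev3 Ω X Y Z) x = ev3 Ω (bracket X Y) Z W x + ev3 Ω (bracket Y Z) X W x
      + ev3 Ω (bracket Z X) Y W x := by
  have h1 : extD Ω x ![X x, Y x, Z x, W x] = 0 := by rw [hd x]; rfl
  rw [extD_three hΩ] at h1
  change lieD X (ev3 Ω Y Z W) x - lieD Y (ev3 Ω X Z W) x + lieD Z (ev3 Ω X Y W) x -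
    lieD W (ev3 Ω X Y Z) x - ev3 Ω (bracket X Y) Z W x + ev3 Ω (bracket X Z) Y W x
    - ev3 Ω (bracket X W) Y Z x - ev3 Ω (bracket Y Z) X W x + ev3 Ω (bracket Y W) X Z x
    - ev3 Ω (bracket Z W) X Y x = 0 at h1
  have p := lieD_ev3_of_ham hΩ hd hα h Y Z W x
  have q := lieD_ev3_of_ham hΩ hd hβ h' X Z W x
  have r := lieD_ev3_of_ham hΩ hd hγ h'' X Y W x
  have s0 : ∀ A B C : VF E M, ev3 Ω A B C x = - ev3 Ω B A C x := fun A B C =>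
    congrFun (ev3_swap01 Ω _ _ _) x
  rw [s0 Y (bracket X Z)] at p
  rw [s0 X (bracket Y Z)] at q
  rw [s0 X (bracket Z Y)] at r
  rw [bracket_swap Y X, ev3_neg, Pi.neg_apply] at q
  rw [bracket_swap Z X, bracket_swap Z Y] at r
  rw [bracket_swap Z X]
  simp only [ev3_neg, Pi.neg_apply] at r ⊢
  have := congrFun (ev3_rot Ω (bracket X W) Y Z) x
  have := congrFun (ev3_rot Ω (bracket Y W) X Z) x
  have := congrFun (ev3_rot Ω (bracket Z W) X Y) x
  linarith

lemma ev3_bracket_ham {Ω : M → E [⋀^Fin 3]→L[ℝ] ℝ} (hΩ : Ω ∈ Form E M 3) (hd : ∀ x, extD Ω x = 0)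
    {α β γ δ : M → E [⋀^Fin 1]→L[ℝ] ℝ} (hα : α ∈ Form E M 1) (hβ : β ∈ Form E M 1)
    (hγ : γ ∈ Form E M 1) (hδ : δ ∈ Form E M 1) {X Y Z T : VF E M}
    (h : IsHamiltonianFor Ω α X) (h' : IsHamiltonianFor Ω β Y) (h'' : IsHamiltonianFor Ω γ Z) (h3 : IsHamiltonianFor Ω δ T) (x : M) :
    ev3 Ω (bracket X Y) Z T x - ev3 Ω (bracket X Z) Y T x + ev3 Ω (bracket X T) Y Z x
      + ev3 Ω (bracket Y Z) X T x - ev3 Ω (bracket Y T) X Z x + ev3 Ω (bracket Z T) X Y x = 0 := by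
  have p := lieD_ev3_ham hΩ hd hα hβ hγ h h' h'' T x
  rw [lieD_ev3_of_ham hΩ hd hδ h3] at p
  have s0 : ∀ A B C : VF E M, ev3 Ω A B C x = - ev3 Ω B A C x := fun A B C =>
    congrFun (ev3_swap01 Ω _ _ _) x
  rw [s0 X (bracket T Y), bracket_swap T X, bracket_swap T Y, bracket_swap T Z, bracket_swap Z X,
    ← ev3_rot Ω _ X Y] at p
  simp only [ev3_neg, Pi.neg_apply] at p
  linarith
end

/-- The dual space of `E`, which models the cotangent spaces of `M`. -/
abbrev Covector (E : Type*) [NormedAddCommGroup E] [NormedSpace ℝ E] := E →L[ℝ] ℝ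

/-- Bilinear forms on the dual space. As `E` is finite-dimensional, `∧² E` is the space of alternating
ones, where `X ∧ Y` is `(ξ, η) ↦ ξ(X) η(Y) - ξ(Y) η(X)`. -/
abbrev BivectorAt (E : Type*) [NormedAddCommGroup E] [NormedSpace ℝ E] :=  Covector E →L[ℝ] Covector E →L[ℝ] ℝ

/-- Precomposition of covectors with an endomorphism. -/
def precomp (A : E →L[ℝ] E) : Covector E →L[ℝ] Covector E := (ContinuousLinearMap.compL ℝ E E ℝ).flip A

lemma precomp_apply (A : E →L[ℝ] E) (ξ : Covector E) : precomp A ξ = ξ.comp A := rfl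

/-- The coordinate expression of a field of bilinear forms on covectors in the chart centred at `x₀`. -/
def bivRep (v : M → BivectorAt E) (x₀ : M) (u : E) : BivectorAt E :=
  (v ((extChartAt 𝓘(ℝ, E) x₀).symm u)).bilinearComp
    (precomp (dChart x₀ ((extChartAt 𝓘(ℝ, E) x₀).symm u)))
    (precomp (dChart x₀ ((extChartAt 𝓘(ℝ, E) x₀).symm u)))

lemma bivRep_apply (v : M → BivectorAt E) (x₀ : M) (u : E) (ξ η : Covector E) : bivRep v x₀ u ξ η =
    v ((extChartAt 𝓘(ℝ, E) x₀).symm u) (ξ.comp (dChart x₀ ((extChartAt 𝓘(ℝ, E) x₀).symm u)))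
     (η.comp (dChart x₀ ((extChartAt 𝓘(ℝ, E) x₀).symm u))) := rfl

variable (E M) in
/-- Smooth bivector fields on `M`. -/
def bivectorFields : Submodule ℝ (M → BivectorAt E) where
  carrier := {v | (∀ x ξ, v x ξ ξ = 0) ∧
    ∀ x₀ : M, ContDiffOn ℝ ∞ (bivRep v x₀) (extChartAt 𝓘(ℝ, E) x₀).target}
  add_mem' {v w} hv hw := ⟨fun x ξ => by
    change v x ξ ξ + w x ξ ξ = 0
    rw [hv.1, hw.1, add_zero], fun x₀ => (hv.2 x₀).add (hw.2 x₀)⟩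
  zero_mem' := ⟨fun _ _ => rfl, fun _ => contDiffOn_const (c := (0 : BivectorAt E))⟩
  smul_mem' c v hv := ⟨fun x ξ => by
    change c * v x ξ ξ = 0
    rw [hv.1, mul_zero], fun x₀ => (hv.2 x₀).const_smul c⟩

/-- The function `v(df, dg)`. -/
def evF (v : M → BivectorAt E) (f g : M → ℝ) (x : M) : ℝ := v x (dAt f x) (dAt g x)

lemma dAt_eq {f : M → ℝ} (hf : ContMDiff 𝓘(ℝ, E) 𝓘(ℝ, ℝ) ∞ f) {x₀ : M} {u : E}
    (hu : u ∈ (extChartAt 𝓘(ℝ, E) x₀).target) :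
    (fderiv ℝ (f ∘ (extChartAt 𝓘(ℝ, E) x₀).symm) u).comp (dChart x₀ ((extChartAt 𝓘(ℝ, E) x₀).symm u)) =
     dAt (E := E) f ((extChartAt 𝓘(ℝ, E) x₀).symm u) := by
  rw [fderiv_rep hf hu]
  ext w
  simp only [ContinuousLinearMap.comp_apply]
  exact congrArg (dAt (E := E) f ((extChartAt 𝓘(ℝ, E) x₀).symm u)) (dChartSymm_comp hu w)

lemma evF_rep (v : M → BivectorAt E) {f g : M → ℝ} (hf : ContMDiff 𝓘(ℝ, E) 𝓘(ℝ, ℝ) ∞ f)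
    (hg : ContMDiff 𝓘(ℝ, E) 𝓘(ℝ, ℝ) ∞ g) {x₀ : M} {u : E}
    (hu : u ∈ (extChartAt 𝓘(ℝ, E) x₀).target) :
    evF v f g ((extChartAt 𝓘(ℝ, E) x₀).symm u) = bivRep v x₀ u
     (fderiv ℝ (f ∘ (extChartAt 𝓘(ℝ, E) x₀).symm) u) (fderiv ℝ (g ∘ (extChartAt 𝓘(ℝ, E) x₀).symm) u) := by
  rw [bivRep_apply, dAt_eq hf hu, dAt_eq hg hu]; rfl

lemma evF_smooth {v : M → BivectorAt E} (hv : v ∈ bivectorFields E M) {f g : M → ℝ} (hf : ContMDiff 𝓘(ℝ, E) 𝓘(ℝ, ℝ) ∞ f)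
    (hg : ContMDiff 𝓘(ℝ, E) 𝓘(ℝ, ℝ) ∞ g) : ContMDiff 𝓘(ℝ, E) 𝓘(ℝ, ℝ) ∞ (evF v f g) := by
  refine smooth_of_rep fun x₀ => ?_
  refine ContDiffOn.congr ?_ (fun u hu => evF_rep v hf hg hu)
  exact ((hv.2 x₀).clm_apply ((rep_smooth hf x₀).fderiv_of_isOpen (isOpen_tgt x₀) (by simp))).clm_apply
    ((rep_smooth hg x₀).fderiv_of_isOpen (isOpen_tgt x₀) (by simp))

section
variable [T2Space M]

lemma exists_fun' (x₀ : M) {u : E} (hu : u ∈ (extChartAt 𝓘(ℝ, E) x₀).target) (ℓ : E →L[ℝ] ℝ) :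
    ∃ f : M → ℝ, ContMDiff 𝓘(ℝ, E) 𝓘(ℝ, ℝ) ∞ f ∧
      (f ∘ (extChartAt 𝓘(ℝ, E) x₀).symm) =ᶠ[𝓝 u] ℓ := by
  obtain ⟨f, hf, hf'⟩ := exists_fun (E := E) x₀ _ ((extChartAt 𝓘(ℝ, E) x₀).map_target hu) ℓ
  refine ⟨f, hf, ?_⟩
  have h3 := (continuousAt_extChartAt_symm'' (I := 𝓘(ℝ, E)) hu)
  filter_upwards [h3.eventually hf', (isOpen_tgt x₀).mem_nhds hu] with u hu hu'
  simp only [Function.comp_apply, hu, (extChartAt 𝓘(ℝ, E) x₀).right_inv hu']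

lemma biv_smooth {v : M → BivectorAt E} (h : ∀ f g : M → ℝ, ContMDiff 𝓘(ℝ, E) 𝓘(ℝ, ℝ) ∞ f →
    ContMDiff 𝓘(ℝ, E) 𝓘(ℝ, ℝ) ∞ g → ContMDiff 𝓘(ℝ, E) 𝓘(ℝ, ℝ) ∞ (evF v f g)) (x₀ : M) :
    ContDiffOn ℝ ∞ (bivRep v x₀) (extChartAt 𝓘(ℝ, E) x₀).target := by
  refine contDiffOn_clm_apply.2 fun ξ => contDiffOn_clm_apply.2 fun η => ?_
  intro u hu
  obtain ⟨f, hf, hf'⟩ := exists_fun' x₀ hu ξ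
  obtain ⟨g, hg, hg'⟩ := exists_fun' x₀ hu η
  have h1 := (rep_smooth (h f g hf hg) x₀).contDiffAt ((isOpen_tgt x₀).mem_nhds hu)
  refine (h1.congr_of_eventuallyEq ?_).contDiffWithinAt
  filter_upwards [hf'.eventuallyEq_nhds, hg'.eventuallyEq_nhds, (isOpen_tgt x₀).mem_nhds hu] with z h1 h2 h3
  rw [Function.comp_apply, evF_rep v hf hg h3, h1.fderiv_eq, h2.fderiv_eq, ξ.fderiv, η.fderiv]

lemma exists_dAt (x : M) (ξ : E →L[ℝ] ℝ) : ∃ f : M → ℝ, ContMDiff 𝓘(ℝ, E) 𝓘(ℝ, ℝ) ∞ f ∧ dAt (E := E) f x = ξ := by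
  obtain ⟨f, hf, hf'⟩ := exists_fun' x (mem_extChartAt_target (I := 𝓘(ℝ, E)) x) ξ
  refine ⟨f, hf, ?_⟩
  have := dAt_eq hf (mem_extChartAt_target (I := 𝓘(ℝ, E)) x)
  rw [hf'.fderiv_eq, ξ.fderiv, extChartAt_to_inv x, dChart_self] at this
  rw [← this]; rfl

lemma biv_ext {v w : M → BivectorAt E} (h : ∀ f g : M → ℝ, ContMDiff 𝓘(ℝ, E) 𝓘(ℝ, ℝ) ∞ f →
    ContMDiff 𝓘(ℝ, E) 𝓘(ℝ, ℝ) ∞ g → ∀ x, evF v f g x = evF w f g x) : v = w := by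
  funext x
  ext ξ η
  obtain ⟨f, hf, hf'⟩ := exists_dAt x ξ
  obtain ⟨g, hg, hg'⟩ := exists_dAt x η
  rw [← hf', ← hg']
  exact h f g hf hg x
end

/-- The Schouten bracket `[X, v]` of a vector field and a bivector field, that is, the Lie derivative of
`v` along `X`. In a chart, `[X, v](ξ, η) = (D_X v)(ξ, η) - v(ξ ∘ DX, η) - v(ξ, η ∘ DX)`; hence
`[X, Y ∧ Z] = [X, Y] ∧ Z + Y ∧ [X, Z]`. -/
def schouten (X : VF E M) (v : M → BivectorAt E) (x : M) : BivectorAt E :=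
  fderiv ℝ (bivRep v x) (extChartAt 𝓘(ℝ, E) x x) (vecRep X x (extChartAt 𝓘(ℝ, E) x x))
  - (bivRep v x (extChartAt 𝓘(ℝ, E) x x)).comp
      (precomp (fderiv ℝ (vecRep X x) (extChartAt 𝓘(ℝ, E) x x)))
  - (bivRep v x (extChartAt 𝓘(ℝ, E) x x)).bilinearComp (.id ℝ _)
      (precomp (fderiv ℝ (vecRep X x) (extChartAt 𝓘(ℝ, E) x x)))

lemma bivRep_self (v : M → BivectorAt E) (x : M) : bivRep v x (extChartAt 𝓘(ℝ, E) x x) = v x := by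
  ext ξ η
  rw [bivRep_apply, extChartAt_to_inv x, dChart_self]; rfl

lemma dAt_self {f : M → ℝ} (hf : ContMDiff 𝓘(ℝ, E) 𝓘(ℝ, ℝ) ∞ f) (x : M) :
    dAt (E := E) f x = fderiv ℝ (f ∘ (extChartAt 𝓘(ℝ, E) x).symm) (extChartAt 𝓘(ℝ, E) x x) := by
  have := dAt_eq hf (mem_extChartAt_target (I := 𝓘(ℝ, E)) x)
  rw [extChartAt_to_inv x, dChart_self] at this
  exact this.symm

lemma evF_schouten (X : VF E M) {v : M → BivectorAt E} (hv : v ∈ bivectorFields E M) {f g : M → ℝ} (hf : ContMDiff 𝓘(ℝ, E) 𝓘(ℝ, ℝ) ∞ f)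
    (hg : ContMDiff 𝓘(ℝ, E) 𝓘(ℝ, ℝ) ∞ g) (x : M) :
    evF (schouten X v) f g x = lieD X (evF v f g) x - evF v (lieD X f) g x - evF v f (lieD X g) x := by
  set y := extChartAt 𝓘(ℝ, E) x x with hy
  have T := tgt_nhds (E := E) x
  rw [lieD_self X (evF_smooth hv hf hg), ← vecRep_self X x]
  have e1 : (evF v f g ∘ (extChartAt 𝓘(ℝ, E) x).symm) =ᶠ[𝓝 y] fun u => bivRep v x u
     (fderiv ℝ (f ∘ (extChartAt 𝓘(ℝ, E) x).symm) u) (fderiv ℝ (g ∘ (extChartAt 𝓘(ℝ, E) x).symm) u) := by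
    filter_upwards [T] with u hu using evF_rep v hf hg hu
  have eD : ∀ f : M → ℝ, ContMDiff 𝓘(ℝ, E) 𝓘(ℝ, ℝ) ∞ f → (lieD X f ∘ (extChartAt 𝓘(ℝ, E) x).symm) =ᶠ[𝓝 y]
      fun u => fderiv ℝ (f ∘ (extChartAt 𝓘(ℝ, E) x).symm) u (vecRep X x u) := fun f hf => by
    filter_upwards [T] with u hu using lieD_rep X hf hu
  have dd : ∀ f : M → ℝ, ContMDiff 𝓘(ℝ, E) 𝓘(ℝ, ℝ) ∞ f →
     DifferentiableAt ℝ (fderiv ℝ (f ∘ (extChartAt 𝓘(ℝ, E) x).symm)) y := fun f hf =>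
    (((rep_smooth hf x).fderiv_of_isOpen (isOpen_tgt x) (m := ∞) (by simp)).contDiffAt T).differentiableAt (by simp)
  have dB : DifferentiableAt ℝ (bivRep v x) y := ((hv.2 x).contDiffAt T).differentiableAt (by simp)
  have dX := diffAt_vecRep X x
  have dL : ∀ f : M → ℝ, ContMDiff 𝓘(ℝ, E) 𝓘(ℝ, ℝ) ∞ f → dAt (E := E) (lieD X f) x =
     (fderiv ℝ (f ∘ (extChartAt 𝓘(ℝ, E) x).symm) y).comp (fderiv ℝ (vecRep X x) y) +
      (fderiv ℝ (fderiv ℝ (f ∘ (extChartAt 𝓘(ℝ, E) x).symm)) y) (vecRep X x y) := fun f hf => by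
    rw [dAt_self (lieD_smooth X hf), (eD f hf).fderiv_eq, fderiv_clm_apply (dd f hf) dX]
    congr 1
    ext w
    have hs : IsSymmSndFDerivAt ℝ (f ∘ (extChartAt 𝓘(ℝ, E) x).symm) y :=
      ((rep_smooth hf x).contDiffAt T).isSymmSndFDerivAt (by simpa using two_le)
    rw [ContinuousLinearMap.flip_apply]
    exact hs w (vecRep X x y)
  have d1 := DifferentiableAt.clm_apply dB (dd f hf)
  rw [e1.fderiv_eq, fderiv_clm_apply d1 (dd g hg), fderiv_clm_apply dB (dd f hf)]
  unfold evF
  rw [dL f hf, dL g hg, dAt_self hf, dAt_self hg]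
  unfold schouten
  rw [← hy, bivRep_self]
  simp only [add_apply, sub_apply, ContinuousLinearMap.comp_apply,
    ContinuousLinearMap.flip_apply, ContinuousLinearMap.bilinearComp_apply, map_add,
    ContinuousLinearMap.id_apply, precomp_apply]
  ring

lemma biv_skew {v : M → BivectorAt E} (hv : v ∈ bivectorFields E M) (x : M) (ξ η : E →L[ℝ] ℝ) : v x ξ η = - v x η ξ := by
  have h := hv.1 x (ξ + η)
  simp only [map_add, add_apply, hv.1, zero_add, add_zero] at h
  linarith

lemma evF_add_left (v : M → BivectorAt E) {f f' : M → ℝ} (hf : ContMDiff 𝓘(ℝ, E) 𝓘(ℝ, ℝ) ∞ f)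
    (hf' : ContMDiff 𝓘(ℝ, E) 𝓘(ℝ, ℝ) ∞ f') (g : M → ℝ) :
    evF v (f + f') g = evF v f g + evF v f' g := by
  funext x; unfold evF; rw [dAt_add hf hf', map_add]; rfl

lemma evF_smul_left (v : M → BivectorAt E) {f : M → ℝ} (hf : ContMDiff 𝓘(ℝ, E) 𝓘(ℝ, ℝ) ∞ f) (c : ℝ)
    (g : M → ℝ) : evF v (c • f) g = c • evF v f g := by
  funext x; unfold evF; rw [dAt_smul hf, map_smul]; rfl

lemma evF_add_right (v : M → BivectorAt E) {f f' : M → ℝ} (hf : ContMDiff 𝓘(ℝ, E) 𝓘(ℝ, ℝ) ∞ f)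
    (hf' : ContMDiff 𝓘(ℝ, E) 𝓘(ℝ, ℝ) ∞ f') (g : M → ℝ) :
    evF v g (f + f') = evF v g f + evF v g f' := by
  funext x; unfold evF; rw [dAt_add hf hf', map_add]; rfl

lemma evF_smul_right (v : M → BivectorAt E) {f : M → ℝ} (hf : ContMDiff 𝓘(ℝ, E) 𝓘(ℝ, ℝ) ∞ f) (c : ℝ)
    (g : M → ℝ) : evF v g (c • f) = c • evF v g f := by
  funext x; unfold evF; rw [dAt_smul hf, map_smul]; rfl

lemma evF_sub_left (v : M → BivectorAt E) {f f' : M → ℝ} (hf : ContMDiff 𝓘(ℝ, E) 𝓘(ℝ, ℝ) ∞ f)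
    (hf' : ContMDiff 𝓘(ℝ, E) 𝓘(ℝ, ℝ) ∞ f') (g : M → ℝ) :
    evF v (f - f') g = evF v f g - evF v f' g := by
  have := evF_add_left v (hf.sub hf') hf' g
  have h : (fun x => f x - f' x) + f' = f := by ext; simp
  rw [h] at this
  rw [this]; exact (add_sub_cancel_right _ _).symm

lemma evF_sub_right (v : M → BivectorAt E) {f f' : M → ℝ} (hf : ContMDiff 𝓘(ℝ, E) 𝓘(ℝ, ℝ) ∞ f)
    (hf' : ContMDiff 𝓘(ℝ, E) 𝓘(ℝ, ℝ) ∞ f') (g : M → ℝ) :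
    evF v g (f - f') = evF v g f - evF v g f' := by
  have := evF_add_right v (hf.sub hf') hf' g
  have h : (fun x => f x - f' x) + f' = f := by ext; simp
  rw [h] at this
  rw [this]; exact (add_sub_cancel_right _ _).symm

section
variable [T2Space M]

lemma schouten_mem (X : VF E M) {v : M → BivectorAt E} (hv : v ∈ bivectorFields E M) : schouten X v ∈ bivectorFields E M := by
  constructor
  · intro x ξ
    obtain ⟨f, hf, hf'⟩ := exists_dAt x ξ
    have h := evF_schouten X hv hf hf x
    have h0 : evF v f f = fun _ => (0 : ℝ) := funext fun y => hv.1 y _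
    have h1 : evF v f (lieD X f) x = - evF v (lieD X f) f x := biv_skew hv x _ _
    rw [h1, h0] at h
    have h2 : lieD X (fun _ : M => (0 : ℝ)) x = 0 := by
      have := lieD_smul X (contMDiff_const (I := 𝓘(ℝ, E)) (I' := 𝓘(ℝ, ℝ)) (n := ∞) (M := M) (c := (0 : ℝ))) 0 x
      rw [zero_mul] at this
      rwa [zero_smul] at this
    rw [h2] at h
    rw [← hf']
    refine Eq.trans h (by ring)
  · refine biv_smooth fun f g hf hg => ?_
    rw [show evF (schouten X v) f g = fun x => lieD X (evF v f g) x - evF v (lieD X f) g x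
      - evF v f (lieD X g) x from funext fun x => evF_schouten X hv hf hg x]
    exact ((lieD_smooth X (evF_smooth hv hf hg)).sub (evF_smooth hv (lieD_smooth X hf) hg)).sub
      (evF_smooth hv hf (lieD_smooth X hg))

lemma schouten_add_left (X Y : VF E M) {v : M → BivectorAt E} (hv : v ∈ bivectorFields E M) :
    schouten (X + Y) v = schouten X v + schouten Y v := by
  refine biv_ext fun f g hf hg x => ?_
  have e : ∀ f, lieD (X + Y) f = lieD X f + lieD Y f := fun f => funext fun y => lieD_VF_add X Y f y
  change _ = evF (schouten X v) f g x + evF (schouten Y v) f g x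
  rw [evF_schouten _ hv hf hg, evF_schouten _ hv hf hg, evF_schouten _ hv hf hg, e, e, e,
    evF_add_left _ (lieD_smooth _ hf) (lieD_smooth _ hf),
    evF_add_right _ (lieD_smooth _ hg) (lieD_smooth _ hg)]
  simp only [Pi.add_apply]; ring

lemma schouten_smul_left (c : ℝ) (X : VF E M) {v : M → BivectorAt E} (hv : v ∈ bivectorFields E M) :
    schouten (c • X) v = c • schouten X v := by
  refine biv_ext fun f g hf hg x => ?_
  have e : ∀ f, lieD (c • X) f = c • lieD X f := fun f => funext fun y => lieD_VF_smul c X f y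
  change _ = c * evF (schouten X v) f g x
  rw [evF_schouten _ hv hf hg, evF_schouten _ hv hf hg, e, e, e,
    evF_smul_left _ (lieD_smooth _ hf),
    evF_smul_right _ (lieD_smooth _ hg)]
  simp only [Pi.smul_apply, smul_eq_mul]; ring

lemma schouten_add_right (X : VF E M) {v w : M → BivectorAt E} (hv : v ∈ bivectorFields E M) (hw : w ∈ bivectorFields E M) :
    schouten X (v + w) = schouten X v + schouten X w := by
  refine biv_ext fun f g hf hg x => ?_
  have e : ∀ f g, evF (v + w) f g = evF v f g + evF w f g := fun f g => rfl
  change _ = evF (schouten X v) f g x + evF (schouten X w) f g x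
  rw [evF_schouten _ ((bivectorFields E M).add_mem hv hw) hf hg, evF_schouten _ hv hf hg, evF_schouten _ hw hf hg, e, e, e,
    lieD_add _ (evF_smooth hv hf hg) (evF_smooth hw hf hg)]
  simp only [Pi.add_apply]; ring

lemma schouten_smul_right (c : ℝ) (X : VF E M) {v : M → BivectorAt E} (hv : v ∈ bivectorFields E M) :
    schouten X (c • v) = c • schouten X v := by
  refine biv_ext fun f g hf hg x => ?_
  have e : ∀ v : M → BivectorAt E, ∀ f g, evF (c • v) f g = c • evF v f g := fun v f g => rfl
  change _ = c * evF (schouten X v) f g x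
  rw [evF_schouten _ ((bivectorFields E M).smul_mem c hv) hf hg, evF_schouten _ hv hf hg, e, e, e,
    lieD_smul _ (evF_smooth hv hf hg)]
  simp only [Pi.smul_apply, smul_eq_mul]; ring

lemma schouten_jacobi (A B : VF E M) {v : M → BivectorAt E} (hv : v ∈ bivectorFields E M) :
    schouten (bracket A B) v = schouten A (schouten B v) - schouten B (schouten A v) := by
  refine biv_ext fun f g hf hg x => ?_
  have hA := schouten_mem A hv
  have hB := schouten_mem B hv
  change _ = evF (schouten A (schouten B v)) f g x - evF (schouten B (schouten A v)) f g x
  have e : ∀ f, ContMDiff 𝓘(ℝ, E) 𝓘(ℝ, ℝ) ∞ f → lieD (bracket A B) f = lieD A (lieD B f) - lieD B (lieD A f) :=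
    fun f hf => funext fun y => lieD_bracket A B hf y
  have k : ∀ (X : VF E M) (f g : M → ℝ), ContMDiff 𝓘(ℝ, E) 𝓘(ℝ, ℝ) ∞ f → ContMDiff 𝓘(ℝ, E) 𝓘(ℝ, ℝ) ∞ g →
     evF (schouten X v) f g = lieD X (evF v f g) - evF v (lieD X f) g - evF v f (lieD X g) :=
    fun X f g hf hg => funext fun x => evF_schouten X hv hf hg x
  have S := fun (X : VF E M) (f : M → ℝ) (hf : ContMDiff 𝓘(ℝ, E) 𝓘(ℝ, ℝ) ∞ f) => lieD_smooth X hf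
  have Q := fun (f g : M → ℝ) (hf : ContMDiff 𝓘(ℝ, E) 𝓘(ℝ, ℝ) ∞ f) (hg : ContMDiff 𝓘(ℝ, E) 𝓘(ℝ, ℝ) ∞ g) =>
    evF_smooth hv hf hg
  have L : ∀ X Y : VF E M, lieD X (lieD Y (evF v f g) - evF v (lieD Y f) g - evF v f (lieD Y g)) x =
      lieD X (lieD Y (evF v f g)) x - lieD X (evF v (lieD Y f) g) x - lieD X (evF v f (lieD Y g)) x :=
    fun X Y => by
      have s1 : ContMDiff 𝓘(ℝ, E) 𝓘(ℝ, ℝ) ∞ (lieD Y (evF v f g) - evF v (lieD Y f) g) :=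
        (S _ _ (Q _ _ hf hg)).sub (Q _ _ (S _ _ hf) hg)
      rw [lieD_sub _ s1 (Q _ _ hf (S _ _ hg)), lieD_sub _ (S _ _ (Q _ _ hf hg)) (Q _ _ (S _ _ hf) hg)]
  rw [evF_schouten _ hv hf hg, evF_schouten _ hB hf hg, evF_schouten _ hA hf hg, k _ _ _ hf hg, k _ _ _ hf hg,
    k _ _ _ (S _ _ hf) hg, k _ _ _ (S _ _ hf) hg, k _ _ _ hf (S _ _ hg), k _ _ _ hf (S _ _ hg),
    e f hf, e g hg, lieD_bracket _ _ (Q _ _ hf hg), L, L,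
    evF_sub_left _ (S _ _ (S _ _ hf)) (S _ _ (S _ _ hf)),
    evF_sub_right _ (S _ _ (S _ _ hg)) (S _ _ (S _ _ hg))]
  simp only [Pi.sub_apply]
  ring
end

variable (E) in
/-- The basis of the dual space that is dual to the chosen basis of `E`. -/
def dualBasis (i : Fin (Module.finrank ℝ E)) : E →L[ℝ] ℝ :=
  LinearMap.toContinuousLinearMap ((Module.finBasis ℝ E).coord i)

/-- The contraction `ι_v a = ½ ∑ v(eⁱ, eʲ) a(e_i, e_j, …)` of a form with a bivector, in the convention
`ι_{X ∧ Y} a = ι_Y ι_X a = a(X, Y, …)`. It does not depend on the basis `e`. -/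
def contract {k : ℕ} (v : BivectorAt E) (a : E [⋀^Fin (k + 2)]→L[ℝ] ℝ) : E [⋀^Fin k]→L[ℝ] ℝ :=
  (1 / 2 : ℝ) • ∑ i, ∑ j, v (dualBasis E i) (dualBasis E j) •
    (a.curryLeft (Module.finBasis ℝ E i)).curryLeft (Module.finBasis ℝ E j)

lemma contract_apply {k : ℕ} (v : BivectorAt E) (a : E [⋀^Fin (k + 2)]→L[ℝ] ℝ) (w : Fin k → E) :
    contract v a w = (1 / 2 : ℝ) * ∑ i, ∑ j, v (dualBasis E i) (dualBasis E j) *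
      a (Matrix.vecCons (Module.finBasis ℝ E i) (Matrix.vecCons (Module.finBasis ℝ E j) w)) := by
  unfold contract
  rw [ContinuousAlternatingMap.smul_apply, ContinuousAlternatingMap.sum_apply]
  simp only [ContinuousAlternatingMap.sum_apply]
  rfl

lemma dual_comp (A : E →L[ℝ] E) (i : Fin (Module.finrank ℝ E)) :
    (dualBasis E i).comp A = ∑ j, (dualBasis E i (A (Module.finBasis ℝ E j))) • dualBasis E j := by
  ext w
  have h := congrArg (fun w => dualBasis E i (A w)) ((Module.finBasis ℝ E).sum_repr w)
  simp only [map_sum, map_smul] at h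
  simp only [ContinuousLinearMap.comp_apply, sum_apply, smul_apply]
  rw [← h]
  exact Finset.sum_congr rfl fun j _ => mul_comm _ _

lemma sum_dual (A : E →L[ℝ] E) (w : E) :
    ∑ i, (dualBasis E i (A w)) • Module.finBasis ℝ E i = A w :=
  (Module.finBasis ℝ E).sum_repr (A w)

lemma tr_swap (A : E →L[ℝ] E) (p : (E →L[ℝ] ℝ) →ₗ[ℝ] E →ₗ[ℝ] ℝ) :
    ∑ i, p ((dualBasis E i).comp A) (Module.finBasis ℝ E i) =
    ∑ i, p (dualBasis E i) (A (Module.finBasis ℝ E i)) := by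
  simp only [dual_comp, map_sum, map_smul, LinearMap.sum_apply, LinearMap.smul_apply]
  rw [Finset.sum_comm]
  refine Finset.sum_congr rfl fun i _ => ?_
  conv_rhs => rw [← sum_dual A]
  simp only [map_sum, map_smul]

/-- An auxiliary bilinear pairing, in the first arguments. -/
def pair1 {k : ℕ} (v : BivectorAt E) (a : E [⋀^Fin (k + 2)]→L[ℝ] ℝ) (w : Fin k → E) (η : E →L[ℝ] ℝ) (f : E) :
   (E →L[ℝ] ℝ) →ₗ[ℝ] E →ₗ[ℝ] ℝ := LinearMap.mk₂ ℝ
    (fun ξ e => v ξ η * a (Matrix.vecCons e (Matrix.vecCons f w)))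
    (fun ξ ξ' e => by simp [add_mul]) (fun c ξ e => by simp [mul_assoc])
    (fun ξ e e' => by rw [alt_cons_add]; ring) (fun c ξ e => by rw [alt_cons_smul, smul_eq_mul]; ring)

/-- An auxiliary bilinear pairing, in the second arguments. -/
def pair2 {k : ℕ} (v : BivectorAt E) (a : E [⋀^Fin (k + 2)]→L[ℝ] ℝ) (w : Fin k → E) (η : E →L[ℝ] ℝ) (f : E) :
   (E →L[ℝ] ℝ) →ₗ[ℝ] E →ₗ[ℝ] ℝ := LinearMap.mk₂ ℝ
    (fun ξ e => v η ξ * a (Matrix.vecCons f (Matrix.vecCons e w)))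
    (fun ξ ξ' e => by simp [add_mul]) (fun c ξ e => by simp [mul_assoc])
    (fun ξ e e' => by
      have := alt_cons_add (a.curryLeft f) e e' w
      change a (Matrix.vecCons f (Matrix.vecCons (e + e') w)) = a (Matrix.vecCons f (Matrix.vecCons e w)) +
        a (Matrix.vecCons f (Matrix.vecCons e' w)) at this
      rw [this]; ring) (fun c ξ e => by
      have := alt_cons_smul (a.curryLeft f) c e w
      change a (Matrix.vecCons f (Matrix.vecCons (c • e) w)) = c * a (Matrix.vecCons f (Matrix.vecCons e w)) at this
      rw [this, smul_eq_mul]; ring)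

lemma tr1 {k : ℕ} (A B C : E →L[ℝ] E) (v : BivectorAt E) (a : E [⋀^Fin (k + 2)]→L[ℝ] ℝ) (w : Fin k → E) :
    ∑ i, ∑ j, v ((dualBasis E i).comp A) ((dualBasis E j).comp B) *
      a (Matrix.vecCons (Module.finBasis ℝ E i) (Matrix.vecCons (C (Module.finBasis ℝ E j)) w)) =
    ∑ i, ∑ j, v (dualBasis E i) ((dualBasis E j).comp B) *
      a (Matrix.vecCons (A (Module.finBasis ℝ E i)) (Matrix.vecCons (C (Module.finBasis ℝ E j)) w)) := by
  rw [Finset.sum_comm, Finset.sum_comm (f := fun i j => v (dualBasis E i) ((dualBasis E j).comp B) * _)]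
  exact Finset.sum_congr rfl fun j _ => tr_swap A (pair1 v a w _ _)

lemma tr2 {k : ℕ} (A B C : E →L[ℝ] E) (v : BivectorAt E) (a : E [⋀^Fin (k + 2)]→L[ℝ] ℝ) (w : Fin k → E) :
    ∑ i, ∑ j, v ((dualBasis E i).comp B) ((dualBasis E j).comp A) *
      a (Matrix.vecCons (C (Module.finBasis ℝ E i)) (Matrix.vecCons (Module.finBasis ℝ E j) w)) =
    ∑ i, ∑ j, v ((dualBasis E i).comp B) (dualBasis E j) *
      a (Matrix.vecCons (C (Module.finBasis ℝ E i)) (Matrix.vecCons (A (Module.finBasis ℝ E j)) w)) :=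
  Finset.sum_congr rfl fun _ _ => tr_swap A (pair2 v a w _ _)

lemma comp_id' (ξ : E →L[ℝ] ℝ) : ξ.comp (.id ℝ E) = ξ := by ext; rfl

lemma contract_pull {k : ℕ} (A B : E →L[ℝ] E) (h : ∀ w, B (A w) = w) (v : BivectorAt E) (a : E [⋀^Fin (k + 2)]→L[ℝ] ℝ) (w : Fin k → E) :
    contract (v.bilinearComp (precomp A) (precomp A)) (a.compContinuousLinearMap B) w = contract v a (B ∘ w) := by
  rw [contract_apply, contract_apply]
  congr 1
  have e : ∀ x y : E, (a.compContinuousLinearMap B) (Matrix.vecCons x (Matrix.vecCons y w)) =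
     a (Matrix.vecCons (B x) (Matrix.vecCons (B y) (B ∘ w))) := fun x y => by
    change a _ = a _
    congr 1
    ext i
    refine Fin.cases rfl (fun i => Fin.cases rfl (fun i => rfl) i) i
  have t1 := tr1 A A (.id ℝ E) v (a.compContinuousLinearMap B) w
  have t2 := tr2 A (.id ℝ E) A v (a.compContinuousLinearMap B) w
  simp only [comp_id', ContinuousLinearMap.id_apply] at t1 t2
  refine t1.trans (t2.trans ?_)
  simp only [e, h]

/-- The contraction `ι_v a` of a differential form with a bivector field. -/
def iotaB {k : ℕ} (v : M → BivectorAt E) (a : M → E [⋀^Fin (k + 2)]→L[ℝ] ℝ) (x : M) : E [⋀^Fin k]→L[ℝ] ℝ :=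
  contract (v x) (a x)

lemma altRep_iotaB {k : ℕ} (v : M → BivectorAt E) (a : M → E [⋀^Fin (k + 2)]→L[ℝ] ℝ) {x₀ : M} {u : E}
    (hu : u ∈ (extChartAt 𝓘(ℝ, E) x₀).target) :
    altRep (iotaB v a) x₀ u = contract (bivRep v x₀ u) (altRep a x₀ u) := by
  ext w
  refine (contract_pull _ _ ?_ _ _ w).symm
  exact dChartSymm_comp hu

lemma iotaB_mem {k : ℕ} {v : M → BivectorAt E} (hv : v ∈ bivectorFields E M) {a : M → E [⋀^Fin (k + 2)]→L[ℝ] ℝ}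
    (ha : a ∈ Form E M (k + 2)) : iotaB v a ∈ Form E M k := by
  intro x₀
  refine ContDiffOn.congr ?_ (fun u hu => altRep_iotaB v a hu)
  refine ContDiffOn.const_smul _ (ContDiffOn.sum fun i _ => ContDiffOn.sum fun j _ => ?_)
  refine ContDiffOn.smul (((hv.2 x₀).clm_apply contDiffOn_const).clm_apply contDiffOn_const) ?_
  exact ((curryCLM (E := E) k).contDiff.comp_contDiffOn
    (((curryCLM (E := E) (k + 1)).contDiff.comp_contDiffOn (ha x₀)).clm_apply contDiffOn_const)).clm_apply contDiffOn_const

section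
variable [T2Space M]

lemma exists_constVF (x : M) (e : E) : ∃ X : VF E M, vecRep X x =ᶠ[𝓝 (extChartAt 𝓘(ℝ, E) x x)] fun _ => e := by
  obtain ⟨ψ, h1, h2, h3⟩ := exists_bump (E := E) x ((isOpen_extChartAt_source (I := 𝓘(ℝ, E)) x).mem_nhds
    (mem_extChartAt_source x))
  let Y : (y : M) → TangentSpace 𝓘(ℝ, E) y := VectorField.mpullback 𝓘(ℝ, E) 𝓘(ℝ, E) (extChartAt 𝓘(ℝ, E) x) (fun _ => e)
  have hY : CMDiff[(extChartAt 𝓘(ℝ, E) x).source] ∞ (T% Y) := by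
    intro y hy
    apply ContMDiffAt.contMDiffWithinAt
    refine ContMDiffAt.mpullback_vectorField_preimage (n := ∞) ?_ ?_ (isInvertible_mfderiv_extChartAt hy) (by simp)
    · exact contMDiffAt_vectorSpace_iff_contDiffAt.2 contDiffAt_const
    · exact contMDiffOn_extChartAt.contMDiffAt ((chartAt E x).open_source.mem_nhds (by simpa using hy))
  refine ⟨⟨ψ • Y, ContMDiffOn.smul_section_of_tsupport h1.contMDiffOn (isOpen_extChartAt_source x) h3 hY⟩, ?_⟩
  have h4 := (continuousAt_extChartAt_symm'' (I := 𝓘(ℝ, E)) (mem_extChartAt_target (I := 𝓘(ℝ, E)) x))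
  rw [ContinuousAt, extChartAt_to_inv] at h4
  filter_upwards [h4.eventually h2, tgt_nhds x] with u hu hu'
  set y := (extChartAt 𝓘(ℝ, E) x).symm u with hy
  change dChart x y (ψ y • (dChart x y).inverse e) = e
  have h5 : ψ y = 1 := hu
  rw [h5, one_smul]
  have h6 : (dChart x y).inverse = dChartSymm x u := by
    apply ContinuousLinearMap.inverse_eq
    · ext v; exact dChart_comp_symm hu' v
    · ext v; exact dChartSymm_comp hu' v
  rw [h6]; exact dChart_comp_symm hu' e

lemma lieD_iotaB {Ω : M → E [⋀^Fin 3]→L[ℝ] ℝ} (hΩ : Ω ∈ Form E M 3) (hd : ∀ x, extD Ω x = 0)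
    {α : M → E [⋀^Fin 1]→L[ℝ] ℝ} (hα : α ∈ Form E M 1) {X : VF E M}
    (h : IsHamiltonianFor Ω α X) {v : M → BivectorAt E} (hv : v ∈ bivectorFields E M) (W : VF E M) (x : M) :
    lieD X (ev1 (iotaB v Ω) W) x = ev1 (iotaB (schouten X v) Ω) W x + ev1 (iotaB v Ω) (bracket X W) x := by
  set y := extChartAt 𝓘(ℝ, E) x x with hy
  choose A hA using fun i => exists_constVF x (Module.finBasis ℝ E i)
  have hAx : ∀ i, A i x = Module.finBasis ℝ E i := fun i => by
    rw [← vecRep_self]; exact (hA i).self_of_nhds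
  have T := tgt_nhds (E := E) x
  have dX := diffAt_vecRep X x
  set D : E →L[ℝ] E := fderiv ℝ (vecRep X x) y with hD
  have hbr : ∀ i, bracket X (A i) x = - D (Module.finBasis ℝ E i) := fun i => by
    rw [bracket_self_pt]
    unfold VectorField.lieBracket
    rw [← hy, (hA i).fderiv_eq, (hA i).self_of_nhds]
    simp only [hD, fderiv_fun_const, Pi.zero_apply, zero_apply, zero_sub]
    rfl
  have sm : ∀ A B C : VF E M, ContMDiff 𝓘(ℝ, E) 𝓘(ℝ, ℝ) ∞ (ev3 Ω A B C) := ev3_smooth hΩ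
  have e1 : (ev1 (iotaB v Ω) W ∘ (extChartAt 𝓘(ℝ, E) x).symm) =ᶠ[𝓝 y] fun u =>
     (1 / 2 : ℝ) * ∑ i, ∑ j, bivRep v x u (dualBasis E i) (dualBasis E j) *
      (ev3 Ω (A i) (A j) W ∘ (extChartAt 𝓘(ℝ, E) x).symm) u := by
    filter_upwards [T, Filter.eventually_all.2 hA] with u hu hA
    have h1 := altRep_apply (iotaB v Ω) x hu ![W]
    have h2 : ev1 (iotaB v Ω) W ((extChartAt 𝓘(ℝ, E) x).symm u) = altRep (iotaB v Ω) x u ![vecRep W x u] := by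
      rw [vec1 (E := E) (fun i => vecRep (![W] i) x u)] at h1
      refine Eq.trans ?_ h1.symm
      exact congrArg (iotaB v Ω ((extChartAt 𝓘(ℝ, E) x).symm u)) (vec1 (E := E)
        (fun i => (![W] i) ((extChartAt 𝓘(ℝ, E) x).symm u))).symm
    rw [Function.comp_apply, h2, altRep_iotaB v Ω hu, contract_apply]
    congr 1
    refine Finset.sum_congr rfl fun i _ => Finset.sum_congr rfl fun j _ => ?_
    congr 1
    have h3 := altRep_apply Ω x hu ![A i, A j, W]
    rw [vec3 (E := E) (fun l => vecRep (![A i, A j, W] l) x u)] at h3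
    rw [← hA i, ← hA j]
    refine h3.trans ?_
    exact congrArg (Ω ((extChartAt 𝓘(ℝ, E) x).symm u)) (vec3 (E := E) _)
  have dB : DifferentiableAt ℝ (bivRep v x) y := ((hv.2 x).contDiffAt T).differentiableAt (by simp)
  have s1 : ContMDiff 𝓘(ℝ, E) 𝓘(ℝ, ℝ) ∞ (ev1 (iotaB v Ω) W) := ev1_smooth (iotaB_mem hv hΩ) W
  rw [lieD_self X s1, e1.fderiv_eq, ← vecRep_self X x]
  have d3 : ∀ i j, HasFDerivAt (ev3 Ω (A i) (A j) W ∘ (extChartAt 𝓘(ℝ, E) x).symm)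
     (fderiv ℝ (ev3 Ω (A i) (A j) W ∘ (extChartAt 𝓘(ℝ, E) x).symm) y) y := fun i j =>
    (diffAt_rep (sm _ _ _) x).hasFDerivAt
  have d4 : ∀ i j, HasFDerivAt (fun u => bivRep v x u (dualBasis E i) (dualBasis E j))
      (((fderiv ℝ (bivRep v x) y).flip (dualBasis E i)).flip (dualBasis E j)) y := fun i j => by
    have := (dB.hasFDerivAt.clm_apply (hasFDerivAt_const (dualBasis E i) y)).clm_apply
       (hasFDerivAt_const (dualBasis E j) y)
    refine this.congr_fderiv ?_
    ext w; simp
  have d5 := (HasFDerivAt.fun_sum fun i (_ : i ∈ Finset.univ) => HasFDerivAt.fun_sum fun j (_ : j ∈ Finset.univ) =>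
     (d4 i j).mul (d3 i j)).const_mul (1 / 2 : ℝ)
  refine (congrArg (fun L : E →L[ℝ] ℝ => L (vecRep X x y)) d5.fderiv).trans ?_
  have p : ∀ i j, fderiv ℝ (ev3 Ω (A i) (A j) W ∘ (extChartAt 𝓘(ℝ, E) x).symm) y (vecRep X x y) =
     - Ω x ![D (Module.finBasis ℝ E i), Module.finBasis ℝ E j, W x]
     - Ω x ![Module.finBasis ℝ E i, D (Module.finBasis ℝ E j), W x] +
      Ω x ![Module.finBasis ℝ E i, Module.finBasis ℝ E j, bracket X W x] := fun i j => by
    rw [vecRep_self, ← lieD_self X (sm _ _ _), lieD_ev3_of_ham hΩ hd hα h]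
    have z1 : ev3 Ω (bracket X (A i)) (A j) W x =
       - Ω x ![D (Module.finBasis ℝ E i), Module.finBasis ℝ E j, W x] := by
      refine Eq.trans ?_ (alt_cons_neg (Ω x) (D (Module.finBasis ℝ E i)) ![Module.finBasis ℝ E j, W x])
      exact congrArg₂ (fun a b : E => Ω x ![a, b, W x]) (hbr i) (hAx j)
    have z2 : ev3 Ω (A i) (bracket X (A j)) W x =
       - Ω x ![Module.finBasis ℝ E i, D (Module.finBasis ℝ E j), W x] := by
      refine Eq.trans ?_ (alt_cons_neg ((Ω x).curryLeft (Module.finBasis ℝ E i))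
        (D (Module.finBasis ℝ E j)) ![W x])
      exact congrArg₂ (fun a b : E => Ω x ![a, b, W x]) (hAx i) (hbr j)
    have z3 : ev3 Ω (A i) (A j) (bracket X W) x =
       Ω x ![Module.finBasis ℝ E i, Module.finBasis ℝ E j, bracket X W x] :=
      congrArg₂ (fun a b : E => Ω x ![a, b, bracket X W x]) (hAx i) (hAx j)
    rw [z1, z2, z3]; ring
  have q1 : ∀ i j, (ev3 Ω (A i) (A j) W ∘ (extChartAt 𝓘(ℝ, E) x).symm) y =
     Ω x ![Module.finBasis ℝ E i, Module.finBasis ℝ E j, W x] := fun i j => by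
    rw [Function.comp_apply, hy, extChartAt_to_inv]
    exact congrArg₂ (fun a b : E => Ω x ![a, b, W x]) (hAx i) (hAx j)
  have sc : ∀ ξ η : E →L[ℝ] ℝ, schouten X v x ξ η = fderiv ℝ (bivRep v x) y (vecRep X x y) ξ η
      - v x (ξ.comp D) η - v x ξ (η.comp D) := fun ξ η => by
    unfold schouten
    rw [bivRep_self]; rfl
  have t1 := tr1 D (.id ℝ E) (.id ℝ E) (v x) (Ω x) ![W x]
  have t2 := tr2 D (.id ℝ E) (.id ℝ E) (v x) (Ω x) ![W x]
  simp only [comp_id', ContinuousLinearMap.id_apply] at t1 t2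
  have c1 := contract_apply (schouten X v x) (Ω x) ![W x]
  have c2 := contract_apply (v x) (Ω x) ![bracket X W x]
  simp only [sc, sub_mul, Finset.sum_sub_distrib] at c1
  rw [t1, t2] at c1
  refine Eq.trans ?_ (congrArg₂ (· + ·) c1 c2).symm
  simp only [smul_apply, sum_apply, add_apply, p, q1, ContinuousLinearMap.flip_apply, smul_eq_mul,
    bivRep_self, ← hy]
  rw [← mul_add]
  congr 1
  simp only [mul_add, mul_sub, mul_neg, Finset.sum_add_distrib, Finset.sum_sub_distrib, Finset.sum_neg_distrib]
  simp only [mul_comm (Ω x _)]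
  have bs : bivRep v x y = v x := bivRep_self v x
  rw [bs]
  ring
end

/-- A Lie 2-algebra over `ℝ`, concentrated in the degrees `-1` (the space `L₁`) and `0` (the space
`L₀`). The mixed bracket is `l2m a x = l₂(a, x)`, and `l₂(x, a)` stands for `-l₂(a, x)`. -/
structure Lie2Algebra (L₁ L₀ : Type*) [AddCommGroup L₁] [Module ℝ L₁] [AddCommGroup L₀]
    [Module ℝ L₀] where
  l1 : L₁ →ₗ[ℝ] L₀
  l2 : L₀ →ₗ[ℝ] L₀ →ₗ[ℝ] L₀
  l2m : L₁ →ₗ[ℝ] L₀ →ₗ[ℝ] L₁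
  l3 : L₀ →ₗ[ℝ] L₀ →ₗ[ℝ] L₀ →ₗ[ℝ] L₁
  l2_self : ∀ x, l2 x x = 0
  l3_self_left : ∀ x y, l3 x x y = 0
  l3_self_right : ∀ x y, l3 x y y = 0
  rel2 : ∀ a x, l1 (-l2m a x) = l2 x (l1 a)
  rel3 : ∀ a b, -l2m b (l1 a) = l2m a (l1 b)
  rel4 : ∀ x y z, l1 (l3 x y z) = -l2 (l2 x y) z - l2 (l2 y z) x - l2 (l2 z x) y
  rel5 : ∀ a x y, l3 (l1 a) x y = l2m a (l2 x y) + l2m (l2m a y) x - l2m (l2m a x) y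
  rel6 : ∀ x y z t,
    l3 (l2 x y) z t - l3 (l2 x z) y t + l3 (l2 x t) y z + l3 (l2 y z) x t - l3 (l2 y t) x z
        + l3 (l2 z t) x y
      = l2m (l3 x y z) t - l2m (l3 x y t) z + l2m (l3 x z t) y - l2m (l3 y z t) x

section
variable {L₁ L₀ L₁' L₀' L₁'' L₀'' : Type*} [AddCommGroup L₁] [Module ℝ L₁] [AddCommGroup L₀]
  [Module ℝ L₀] [AddCommGroup L₁'] [Module ℝ L₁'] [AddCommGroup L₀'] [Module ℝ L₀']
  [AddCommGroup L₁''] [Module ℝ L₁''] [AddCommGroup L₀''] [Module ℝ L₀'']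

/-- The degree `0` part is a Lie algebra under `l₂`: the Jacobi identity holds. -/
def Lie2Algebra.ZeroIsLie (L : Lie2Algebra L₁ L₀) : Prop :=
  ∀ x y z, L.l2 (L.l2 x y) z + L.l2 (L.l2 y z) x + L.l2 (L.l2 z x) y = 0

/-- A morphism of Lie 2-algebras, with components `F10`, `F1m` in the degrees `0`, `-1` and `F2`. -/
@[ext]
structure Lie2Hom (L : Lie2Algebra L₁ L₀) (L' : Lie2Algebra L₁' L₀') where
  F10 : L₀ →ₗ[ℝ] L₀'
  F1m : L₁ →ₗ[ℝ] L₁'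
  F2 : L₀ →ₗ[ℝ] L₀ →ₗ[ℝ] L₁'
  F2_self : ∀ x, F2 x x = 0
  rel1 : ∀ a, L'.l1 (F1m a) = F10 (L.l1 a)
  rel2 : ∀ x y, L'.l1 (F2 x y) = F10 (L.l2 x y) - L'.l2 (F10 x) (F10 y)
  rel3 : ∀ a x, F1m (L.l2m a x) = F2 (L.l1 a) x + L'.l2m (F1m a) (F10 x)
  rel4 : ∀ x y z,
    F1m (L.l3 x y z) + (F2 (L.l2 x y) z + F2 (L.l2 y z) x + F2 (L.l2 z x) y)
      = L'.l3 (F10 x) (F10 y) (F10 z)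
        + (-L'.l2m (F2 y z) (F10 x) - L'.l2m (F2 z x) (F10 y) - L'.l2m (F2 x y) (F10 z))

lemma Lie2Algebra.l2_skew (L : Lie2Algebra L₁ L₀) (x y : L₀) : L.l2 x y = -L.l2 y x := by
  have h := L.l2_self (x + y)
  simp only [map_add, LinearMap.add_apply, L.l2_self, zero_add, add_zero] at h
  exact eq_neg_of_add_eq_zero_right h

lemma Lie2Hom.F2_skew {L : Lie2Algebra L₁ L₀} {L' : Lie2Algebra L₁' L₀'} (F : Lie2Hom L L')
    (x y : L₀) : F.F2 x y = -F.F2 y x := by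
  have h := F.F2_self (x + y)
  simp only [map_add, LinearMap.add_apply, F.F2_self, zero_add, add_zero] at h
  exact eq_neg_of_add_eq_zero_right h

/-- The composition `G ∘ F`, with `(G ∘ F)₂ = G₂ ∘ (F₁₀ × F₁₀) + G₁₋₁ ∘ F₂`. -/
def Lie2Hom.comp {L : Lie2Algebra L₁ L₀} {L' : Lie2Algebra L₁' L₀'} {L'' : Lie2Algebra L₁'' L₀''}
    (G : Lie2Hom L' L'') (F : Lie2Hom L L') : Lie2Hom L L'' where
  F10 := G.F10 ∘ₗ F.F10
  F1m := G.F1m ∘ₗ F.F1m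
  F2 := G.F2.compl₁₂ F.F10 F.F10 + F.F2.compr₂ G.F1m
  F2_self x := by simp [F.F2_self, G.F2_self]
  rel1 a := by simp [F.rel1, G.rel1]
  rel2 x y := by
    simp only [LinearMap.add_apply, LinearMap.compl₁₂_apply, LinearMap.compr₂_apply, map_add,
      G.rel2, G.rel1, F.rel2, LinearMap.comp_apply, map_sub]
    abel
  rel3 a x := by
    simp only [LinearMap.add_apply, LinearMap.compl₁₂_apply, LinearMap.compr₂_apply, map_add,
      G.rel3, F.rel3, F.rel1, LinearMap.comp_apply]
    abel
  rel4 x y z := by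
    have h := congrArg G.F1m (F.rel4 x y z)
    have h2 := G.rel4 (F.F10 x) (F.F10 y) (F.F10 z)
    have k : ∀ x y z, G.F2 (F.F10 (L.l2 x y)) (F.F10 z) =
      G.F2 (L'.l1 (F.F2 x y)) (F.F10 z) + G.F2 (L'.l2 (F.F10 x) (F.F10 y)) (F.F10 z) := by
      intro x y z
      rw [← LinearMap.add_apply, ← map_add, F.rel2, sub_add_cancel]
    simp only [map_add, map_sub, map_neg, G.rel3] at h
    simp only [LinearMap.add_apply, LinearMap.compl₁₂_apply, LinearMap.compr₂_apply, map_add,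
      LinearMap.comp_apply, k]
    have e := congrArg₂ (· + ·) h h2
    rw [← sub_eq_zero] at e ⊢
    rw [← e]
    abel
end

variable (E M) in
/-- The space of smooth bivector fields on `M`. -/
def BivectorField : Type _ := bivectorFields E M

instance : AddCommGroup (BivectorField E M) := Submodule.addCommGroup (bivectorFields E M)
instance : Module ℝ (BivectorField E M) := Submodule.module (bivectorFields E M)

section
variable [T2Space M]

variable (E M) in
/-- The Schouten bracket `(X, v) ↦ [X, v]` as a bilinear map. -/
def schoutenMap : VF E M →ₗ[ℝ] BivectorField E M →ₗ[ℝ] BivectorField E M :=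
  LinearMap.mk₂ ℝ (fun Z v => ⟨schouten Z v.1, schouten_mem Z v.2⟩)
    (fun Z W v => Subtype.ext (schouten_add_left Z W v.2))
    (fun c Z v => Subtype.ext (schouten_smul_left c Z v.2))
    (fun Z v v' => Subtype.ext (schouten_add_right Z v.2 v'.2))
    (fun c Z v => Subtype.ext (schouten_smul_right c Z v.2))

variable (E M) in
/-- The Lie bracket of vector fields as a bilinear map. -/
def bracketMap : VF E M →ₗ[ℝ] VF E M →ₗ[ℝ] VF E M :=
  LinearMap.mk₂ ℝ bracket bracket_add_left bracket_smul_left bracket_add_right bracket_smul_right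

lemma schoutenMap_jacobi (X Y : VF E M) (v : BivectorField E M) :
    schoutenMap E M (bracket X Y) v =
      schoutenMap E M X (schoutenMap E M Y v) - schoutenMap E M Y (schoutenMap E M X v) :=
  Subtype.ext (schouten_jacobi X Y v.2)

variable (E M) in
/-- The Lie 2-algebra of bivector fields and vector fields, where `l₁ = 0`, `l₃ = 0` and `l₂` is the
Schouten bracket, with `l₂(v, X) = -[X, v]` in mixed degrees. -/
def multivectorAlgebra : Lie2Algebra (BivectorField E M) (VF E M) where
  l1 := 0
  l2 := bracketMap E M
  l2m := -(schoutenMap E M).flip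
  l3 := 0
  l2_self := bracket_self
  l3_self_left _ _ := rfl
  l3_self_right _ _ := rfl
  rel2 a x := by
    simp only [LinearMap.zero_apply, map_zero]
  rel3 a b := by
    simp only [LinearMap.zero_apply, map_zero, neg_zero]
  rel4 x y z := by
    change 0 = -bracket (bracket x y) z - bracket (bracket y z) x - bracket (bracket z x) y
    rw [bracket_swap (bracket y z) x, bracket_jacobi x y z, bracket_swap z x, bracket_neg_left,
      bracket_swap y (bracket x z)]
    abel
  rel5 a x y := by
    change 0 = -schoutenMap E M (bracket x y) a + -schoutenMap E M x (-schoutenMap E M y a)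
      - -schoutenMap E M y (-schoutenMap E M x a)
    rw [schoutenMap_jacobi, map_neg, map_neg]
    abel
  rel6 x y z t := by
    simp only [LinearMap.zero_apply, map_zero, add_zero, sub_zero]
end

/-- Smooth real-valued functions on `M`. -/
abbrev SmoothFn (E : Type*) [NormedAddCommGroup E] [NormedSpace ℝ E] (M : Type*) [TopologicalSpace M]
  [ChartedSpace E M] := C^∞⟮𝓘(ℝ, E), M; 𝓘(ℝ, ℝ), ℝ⟯

variable (E M) in
/-- A 2-plectic form on `M`: a closed and nondegenerate `3`-form. -/
structure TwoPlecticForm where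
  form : M → E [⋀^Fin 3]→L[ℝ] ℝ
  smooth : form ∈ Form E M 3
  closed : ∀ x, extD form x = 0
  nondegenerate : ∀ (x : M) (v : E), (form x).curryLeft v = 0 → v = 0

variable (w : TwoPlecticForm E M)

lemma ham_unique {α : M → E [⋀^Fin 1]→L[ℝ] ℝ} {X Y : VF E M} (hX : IsHamiltonianFor w.form α X)
    (hY : IsHamiltonianFor w.form α Y) : X = Y := by
  ext x
  have h : (w.form x).curryLeft (X x : E) = (w.form x).curryLeft (Y x : E) :=
    neg_injective ((hX x).symm.trans (hY x))
  have h2 : (w.form x).curryLeft ((X x : E) - (Y x : E)) = 0 :=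
    ((curryCLM (E := E) 2 (w.form x)).map_sub (X x : E) (Y x : E)).trans (sub_eq_zero.2 h)
  exact sub_eq_zero.1 (w.nondegenerate x _ h2)

lemma iota_add {k : ℕ} (X Y : VF E M) (a : M → E [⋀^Fin (k + 1)]→L[ℝ] ℝ) (x : M) :
    iota (X + Y) a x = iota X a x + iota Y a x :=
  (curryCLM (E := E) k (a x)).map_add (X x : E) (Y x : E)

lemma iota_smul {k : ℕ} (c : ℝ) (X : VF E M) (a : M → E [⋀^Fin (k + 1)]→L[ℝ] ℝ) (x : M) :
    iota (c • X) a x = c • iota X a x :=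
  (curryCLM (E := E) k (a x)).map_smul c (X x : E)

lemma iota_zero {k : ℕ} (a : M → E [⋀^Fin (k + 1)]→L[ℝ] ℝ) (x : M) :
    iota (0 : VF E M) a x = 0 :=
  (curryCLM (E := E) k (a x)).map_zero

lemma iota_form_add {k : ℕ} (X : VF E M) (a b : M → E [⋀^Fin (k + 1)]→L[ℝ] ℝ) :
    iota X (a + b) = iota X a + iota X b := rfl

/-- Hamiltonian `1`-forms. -/
def HamForm : Submodule ℝ (M → E [⋀^Fin 1]→L[ℝ] ℝ) where
  carrier := {α | α ∈ Form E M 1 ∧ ∃ X : VF E M, IsHamiltonianFor w.form α X}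
  add_mem' := by
    rintro α β ⟨hα, X, hX⟩ ⟨hβ, Y, hY⟩
    refine ⟨(Form E M 1).add_mem hα hβ, X + Y, fun x => ?_⟩
    rw [extD_add hα hβ, iota_add, hX, hY, neg_add]
  zero_mem' := ⟨(Form E M 1).zero_mem, 0, fun x => by
    rw [iota_zero, neg_zero]
    simpa using extD_smul (0 : ℝ) (0 : M → E [⋀^Fin 1]→L[ℝ] ℝ) x⟩
  smul_mem' := by
    rintro c α ⟨hα, X, hX⟩
    refine ⟨(Form E M 1).smul_mem c hα, c • X, fun x => ?_⟩
    rw [extD_smul, iota_smul, hX, smul_neg]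

lemma HamForm.mem_form (α : HamForm w) : (α : M → E [⋀^Fin 1]→L[ℝ] ℝ) ∈ Form E M 1 := α.2.1

/-- The Hamiltonian vector field `X_α` of a Hamiltonian `1`-form, unique by nondegeneracy. -/
def hamVF : HamForm w →ₗ[ℝ] VF E M where
  toFun α := α.2.2.choose
  map_add' α β := by
    refine ham_unique w (α + β).2.2.choose_spec fun x => ?_
    refine (extD_add α.2.1 β.2.1 x).trans ?_
    rw [α.2.2.choose_spec x, β.2.2.choose_spec x, iota_add, neg_add]
  map_smul' c α := by
    refine ham_unique w (c • α).2.2.choose_spec fun x => ?_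
    refine (extD_smul c (α : M → E [⋀^Fin 1]→L[ℝ] ℝ) x).trans ?_
    rw [α.2.2.choose_spec x, RingHom.id_apply, iota_smul, smul_neg]

lemma hamVF_spec (α : HamForm w) : IsHamiltonianFor w.form α (hamVF w α) := α.2.2.choose_spec

lemma hamVF_eq (α : HamForm w) {X : VF E M} (h : IsHamiltonianFor w.form α X) : hamVF w α = X :=
  ham_unique w (hamVF_spec w α) h

section
variable [T2Space M]

/-- The differential, from functions to Hamiltonian `1`-forms. -/
def diff : SmoothFn E M →ₗ[ℝ] HamForm w where
  toFun f := ⟨dFun f, dFun_mem f.contMDiff, 0, fun x => by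
    rw [extD_dFun f.contMDiff, iota_zero, neg_zero]⟩
  map_add' f g := Subtype.ext (dFun_add f.contMDiff g.contMDiff)
  map_smul' c f := Subtype.ext (dFun_smul f.contMDiff c)

lemma hamVF_diff (f : SmoothFn E M) : hamVF w (diff w f) = 0 :=
  hamVF_eq w _ fun x => by
    change extD (dFun f) x = _
    rw [extD_dFun f.contMDiff, iota_zero, neg_zero]

/-- The bracket `(α, β) ↦ ι_{X_α ∧ X_β} ω = ι_{X_β} ι_{X_α} ω` of Hamiltonian `1`-forms. -/
def hamBracket : HamForm w →ₗ[ℝ] HamForm w →ₗ[ℝ] HamForm w :=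
  LinearMap.mk₂ ℝ (fun α β => ⟨iota (hamVF w β) (iota (hamVF w α) w.form),
      iota_mem _ (iota_mem _ w.smooth), bracket (hamVF w α) (hamVF w β),
      isHamiltonianFor_bracket w.smooth w.closed α.2.1 β.2.1 (hamVF_spec w α) (hamVF_spec w β)⟩)
    (fun α β γ => Subtype.ext (by
      funext x
      change iota _ (iota (hamVF w (α + β)) w.form) x =
        iota _ (iota (hamVF w α) w.form) x + iota _ (iota (hamVF w β) w.form) x
      rw [map_add, show iota (hamVF w α + hamVF w β) w.form =
        iota (hamVF w α) w.form + iota (hamVF w β) w.form from funext fun x => iota_add _ _ _ x]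
      rfl))
    (fun c α γ => Subtype.ext (by
      funext x
      change iota _ (iota (hamVF w (c • α)) w.form) x =
        c • iota _ (iota (hamVF w α) w.form) x
      rw [map_smul, show iota (c • hamVF w α) w.form =
        c • iota (hamVF w α) w.form from funext fun x => iota_smul _ _ _ x]
      rfl))
    (fun α β γ => Subtype.ext (by
      funext x
      change iota (hamVF w (β + γ)) _ x = iota (hamVF w β) _ x + iota (hamVF w γ) _ x
      rw [map_add, iota_add]))
    (fun c α β => Subtype.ext (by
      funext x
      change iota (hamVF w (c • β)) _ x = c • iota (hamVF w β) _ x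
      rw [map_smul, iota_smul]))

lemma hamVF_bracket (α β : HamForm w) :
    hamVF w (hamBracket w α β) = bracket (hamVF w α) (hamVF w β) :=
  hamVF_eq w _ (isHamiltonianFor_bracket w.smooth w.closed α.2.1 β.2.1 (hamVF_spec w α) (hamVF_spec w β))

lemma ev3_add_mid (a : M → E [⋀^Fin 3]→L[ℝ] ℝ) (A B B' C : VF E M) :
    ev3 a A (B + B') C = ev3 a A B C + ev3 a A B' C := by
  rw [ev3_swap01, ev3_add, ev3_swap01 a A B, ev3_swap01 a A B', neg_add]
lemma ev3_smul_mid (a : M → E [⋀^Fin 3]→L[ℝ] ℝ) (c : ℝ) (A B C : VF E M) :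
    ev3 a A (c • B) C = c • ev3 a A B C := by
  rw [ev3_swap01, ev3_smul, ev3_swap01 a A B, smul_neg]
lemma ev3_add_right (a : M → E [⋀^Fin 3]→L[ℝ] ℝ) (A B C C' : VF E M) :
    ev3 a A B (C + C') = ev3 a A B C + ev3 a A B C' := by
  rw [ev3_swap12, ev3_add_mid, ev3_swap12 a A B C, ev3_swap12 a A B C', neg_add]
lemma ev3_smul_right (a : M → E [⋀^Fin 3]→L[ℝ] ℝ) (c : ℝ) (A B C : VF E M) :
    ev3 a A B (c • C) = c • ev3 a A B C := by
  rw [ev3_swap12, ev3_smul_mid, ev3_swap12 a A B C, smul_neg]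

/-- The map `(α, β, γ) ↦ -ω(X_α, X_β, X_γ)` on Hamiltonian `1`-forms. -/
def hamTriple : HamForm w →ₗ[ℝ] HamForm w →ₗ[ℝ] HamForm w →ₗ[ℝ] SmoothFn E M :=
  LinearMap.mk₂ ℝ (fun α β =>
    { toFun := fun γ => ⟨fun x => -(w.form x ![hamVF w α x, hamVF w β x, hamVF w γ x]),
        (ev3_smooth w.smooth (hamVF w α) (hamVF w β) (hamVF w γ)).neg⟩
      map_add' := fun γ γ' => ContMDiffMap.ext fun x => by
        change -ev3 w.form _ _ (hamVF w (γ + γ')) x = -ev3 w.form _ _ _ x + -ev3 w.form _ _ _ x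
        rw [map_add, ev3_add_right, Pi.add_apply, neg_add]
      map_smul' := fun c γ => ContMDiffMap.ext fun x => by
        change -ev3 w.form _ _ (hamVF w (c • γ)) x = c * -ev3 w.form _ _ _ x
        rw [map_smul, ev3_smul_right, Pi.smul_apply, smul_eq_mul, mul_neg] })
    (fun α α' β => LinearMap.ext fun γ => ContMDiffMap.ext fun x => by
      change -ev3 w.form (hamVF w (α + α')) _ _ x = -ev3 w.form _ _ _ x + -ev3 w.form _ _ _ x
      rw [map_add, ev3_add, Pi.add_apply, neg_add])
    (fun c α β => LinearMap.ext fun γ => ContMDiffMap.ext fun x => by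
      change -ev3 w.form (hamVF w (c • α)) _ _ x = c * -ev3 w.form _ _ _ x
      rw [map_smul, ev3_smul, Pi.smul_apply, smul_eq_mul, mul_neg])
    (fun α β β' => LinearMap.ext fun γ => ContMDiffMap.ext fun x => by
      change -ev3 w.form _ (hamVF w (β + β')) _ x = -ev3 w.form _ _ _ x + -ev3 w.form _ _ _ x
      rw [map_add, ev3_add_mid, Pi.add_apply, neg_add])
    (fun c α β => LinearMap.ext fun γ => ContMDiffMap.ext fun x => by
      change -ev3 w.form _ (hamVF w (c • β)) _ x = c * -ev3 w.form _ _ _ x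
      rw [map_smul, ev3_smul_mid, Pi.smul_apply, smul_eq_mul, mul_neg])

lemma hamTriple_apply (α β γ : HamForm w) (x : M) :
    hamTriple w α β γ x = -ev3 w.form (hamVF w α) (hamVF w β) (hamVF w γ) x := rfl

lemma hamBracket_self (α : HamForm w) : hamBracket w α α = 0 :=
  Subtype.ext (funext fun x => ext1 (x := x) fun A => congrFun (ev3_self w.form (hamVF w α) A) x)

lemma hamTriple_self_left (α β : HamForm w) : hamTriple w α α β = 0 :=
  ContMDiffMap.ext fun x => by
    rw [hamTriple_apply, ev3_self]; simp

lemma hamTriple_self_right (α β : HamForm w) : hamTriple w α β β = 0 :=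
  ContMDiffMap.ext fun x => by
    rw [hamTriple_apply, ev3_rot, ev3_self]; simp

lemma hamBracket_diff (α : HamForm w) (f : SmoothFn E M) : hamBracket w α (diff w f) = 0 :=
  Subtype.ext (funext fun x => by
    change iota (hamVF w (diff w f)) _ x = 0
    rw [hamVF_diff, iota_zero])

lemma hamTriple_diff (f : SmoothFn E M) (α β : HamForm w) : hamTriple w (diff w f) α β = 0 :=
  ContMDiffMap.ext fun x => by
    rw [hamTriple_apply, hamVF_diff]
    have := congrFun (ev3_smul w.form 0 0 (hamVF w α) (hamVF w β)) x
    rw [zero_smul, zero_smul] at this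
    rw [this]; simp

lemma diff_hamTriple (α β γ : HamForm w) : diff w (hamTriple w α β γ) =
    -hamBracket w (hamBracket w α β) γ - hamBracket w (hamBracket w β γ) α
      - hamBracket w (hamBracket w γ α) β := by
  refine Subtype.ext (funext fun x => ext1 (x := x) fun A => ?_)
  change lieD A (-ev3 w.form (hamVF w α) (hamVF w β) (hamVF w γ)) x =
    -ev3 w.form (hamVF w (hamBracket w α β)) (hamVF w γ) A x
    - ev3 w.form (hamVF w (hamBracket w β γ)) (hamVF w α) A x
    - ev3 w.form (hamVF w (hamBracket w γ α)) (hamVF w β) A x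
  rw [hamVF_bracket, hamVF_bracket, hamVF_bracket, lieD_neg _ (f := ev3 w.form _ _ _) (ev3_smooth w.smooth _ _ _),
    lieD_ev3_ham w.smooth w.closed α.2.1 β.2.1 γ.2.1 (hamVF_spec w _) (hamVF_spec w _) (hamVF_spec w _)]
  ring

lemma hamTriple_rel (x y z t : HamForm w) :
    hamTriple w (hamBracket w x y) z t - hamTriple w (hamBracket w x z) y t
      + hamTriple w (hamBracket w x t) y z + hamTriple w (hamBracket w y z) x t
      - hamTriple w (hamBracket w y t) x z + hamTriple w (hamBracket w z t) x y = 0 := by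
  refine ContMDiffMap.ext fun p => ?_
  have h := ev3_bracket_ham w.smooth w.closed x.2.1 y.2.1 z.2.1 t.2.1 (hamVF_spec w _) (hamVF_spec w _)
    (hamVF_spec w _) (hamVF_spec w _) p
  change -ev3 w.form (hamVF w (hamBracket w x y)) _ _ p
    - -ev3 w.form (hamVF w (hamBracket w x z)) _ _ p
    + -ev3 w.form (hamVF w (hamBracket w x t)) _ _ p
    + -ev3 w.form (hamVF w (hamBracket w y z)) _ _ p
    - -ev3 w.form (hamVF w (hamBracket w y t)) _ _ p
    + -ev3 w.form (hamVF w (hamBracket w z t)) _ _ p = 0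
  simp only [hamVF_bracket]
  linarith

/-- The Lie 2-algebra `L²(M, ω)` of functions and Hamiltonian `1`-forms. -/
def rogersAlgebra : Lie2Algebra (SmoothFn E M) (HamForm w) where
  l1 := diff w
  l2 := hamBracket w
  l2m := 0
  l3 := hamTriple w
  l2_self := hamBracket_self w
  l3_self_left := hamTriple_self_left w
  l3_self_right := hamTriple_self_right w
  rel2 a x := by simp [hamBracket_diff]
  rel3 a b := by simp
  rel4 := diff_hamTriple w
  rel5 a x y := by simp [hamTriple_diff]
  rel6 x y z t := by simpa using hamTriple_rel w x y z t
end

lemma contract_add {k : ℕ} (v v' : BivectorAt E) (a : E [⋀^Fin (k + 2)]→L[ℝ] ℝ) :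
    contract (v + v') a = contract v a + contract v' a := by
  ext u
  rw [ContinuousAlternatingMap.add_apply]
  simp only [contract_apply, add_apply, add_mul, Finset.sum_add_distrib, mul_add]

lemma contract_smul {k : ℕ} (c : ℝ) (v : BivectorAt E) (a : E [⋀^Fin (k + 2)]→L[ℝ] ℝ) :
    contract (c • v) a = c • contract v a := by
  ext u
  rw [ContinuousAlternatingMap.smul_apply]
  simp only [contract_apply, smul_apply, smul_eq_mul, mul_assoc, ← Finset.mul_sum]
  ring

lemma contract_zero {k : ℕ} (a : E [⋀^Fin (k + 2)]→L[ℝ] ℝ) : contract (0 : BivectorAt E) a = 0 := by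
  ext u
  simp only [contract_apply, zero_apply, zero_mul, Finset.sum_const_zero, mul_zero]
  rfl

lemma contract_neg {k : ℕ} (v : BivectorAt E) (a : E [⋀^Fin (k + 2)]→L[ℝ] ℝ) :
    contract (-v) a = -contract v a := by
  ext u
  rw [ContinuousAlternatingMap.neg_apply]
  simp only [contract_apply, neg_apply, neg_mul, Finset.sum_neg_distrib, mul_neg]

/-- Hamiltonian pairs: a function `f` and a bivector field `v` with `df = -ι_v ω`. -/
def HamPair : Submodule ℝ (SmoothFn E M × BivectorField E M) where
  carrier := {p | ∀ x, dFun (E := E) p.1 x = -iotaB p.2.1 w.form x}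
  add_mem' {p q} hp hq x := by
    have h1 := congrFun (dFun_add (E := E) p.1.contMDiff q.1.contMDiff) x
    refine h1.trans ?_
    rw [Pi.add_apply, hp x, hq x]
    exact (neg_add _ _).symm.trans (congrArg Neg.neg (contract_add (p.2.1 x) (q.2.1 x) _).symm)
  zero_mem' x := by
    have h1 := congrFun (dFun_smul (E := E) (contMDiff_const (c := (0 : ℝ))) (0 : ℝ)) x
    rw [zero_smul, zero_smul] at h1
    refine h1.trans (Eq.trans ?_ (congrArg Neg.neg (contract_zero (w.form x)).symm))
    exact neg_zero.symm
  smul_mem' c p hp x := by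
    have h1 := congrFun (dFun_smul (E := E) p.1.contMDiff c) x
    refine h1.trans ?_
    rw [Pi.smul_apply, hp x]
    exact (smul_neg _ _).trans (congrArg Neg.neg (contract_smul c (p.2.1 x) _).symm)

lemma HamPair_eq (p : HamPair w) (Z : VF E M) : ev1 (iotaB p.1.2.1 w.form) Z = - lieD Z p.1.1 := by
  funext x
  have h := congrArg (fun a : E [⋀^Fin 1]→L[ℝ] ℝ => a ![Z x]) (p.2 x)
  change lieD Z p.1.1 x = -ev1 (iotaB p.1.2.1 w.form) Z x at h
  rw [Pi.neg_apply, h, neg_neg]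

section
variable [T2Space M]

lemma hamPair_bracket {f : M → ℝ} (hf : ContMDiff 𝓘(ℝ, E) 𝓘(ℝ, ℝ) ∞ f) {v : M → BivectorAt E}
    (hv : v ∈ bivectorFields E M) (h : ∀ x, dFun (E := E) f x = -iotaB v w.form x) (α : HamForm w) (x : M) :
    dFun (E := E) (ev1 (iotaB v w.form) (hamVF w α)) x
      = iotaB (schouten (hamVF w α) v) w.form x := by
  refine ext1 (x := x) fun A => ?_
  have e : ∀ Z : VF E M, ev1 (iotaB v w.form) Z = -lieD Z f := fun Z => by
    funext x
    have h := congrArg (fun a : E [⋀^Fin 1]→L[ℝ] ℝ => a ![Z x]) (h x)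
    change lieD Z f x = -ev1 (iotaB v w.form) Z x at h
    rw [Pi.neg_apply, h, neg_neg]
  have k := lieD_iotaB w.smooth w.closed α.2.1 (hamVF_spec w α) hv A x
  change lieD A (ev1 (iotaB v w.form) (hamVF w α)) x =
    ev1 (iotaB (schouten (hamVF w α) v) w.form) A x
  rw [e, e, Pi.neg_apply, lieD_neg _ (lieD_smooth _ hf), lieD_bracket _ _ hf] at k
  rw [e, lieD_neg _ (lieD_smooth _ hf)]
  linarith

/-- The map `((f, v), α) ↦ (ι_{v ∧ X_α} ω, [v, X_α])`, where `ι_{v ∧ X} ω = ι_X ι_v ω` and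
`[v, X] = -[X, v]`. -/
def hamPairBracket : HamPair w →ₗ[ℝ] HamForm w →ₗ[ℝ] HamPair w :=
  LinearMap.mk₂ ℝ
    (fun p α => ⟨(⟨fun x => iotaB p.1.2.1 w.form x ![hamVF w α x],
        ev1_smooth (iotaB_mem p.1.2.2 w.smooth) (hamVF w α)⟩,
        (multivectorAlgebra E M).l2m p.1.2 (hamVF w α)), fun x =>
      (hamPair_bracket w p.1.1.contMDiff p.1.2.2 p.2 α x).trans (by
        change _ = -contract (-schouten (hamVF w α) p.1.2.1 x) (w.form x)
        exact (neg_eq_iff_eq_neg.2 (contract_neg (schouten (hamVF w α) p.1.2.1 x)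
          (w.form x))).symm)⟩)
    (fun p q α => Subtype.ext (Prod.ext (ContMDiffMap.ext fun x =>
      congrArg (fun a : E [⋀^Fin 1]→L[ℝ] ℝ => a ![hamVF w α x])
        (contract_add (p.1.2.1 x) (q.1.2.1 x) (w.form x)))
      (((multivectorAlgebra E M).l2m.map_add₂ p.1.2 q.1.2 (hamVF w α)))))
    (fun c p α => Subtype.ext (Prod.ext (ContMDiffMap.ext fun x =>
      congrArg (fun a : E [⋀^Fin 1]→L[ℝ] ℝ => a ![hamVF w α x])
        (contract_smul c (p.1.2.1 x) (w.form x)))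
      (((multivectorAlgebra E M).l2m.map_smul₂ c p.1.2 (hamVF w α)))))
    (fun p α β => Subtype.ext (Prod.ext (ContMDiffMap.ext fun x => by
        change ev1 (iotaB p.1.2.1 w.form) (hamVF w (α + β)) x = _
        rw [map_add, ev1_add_right]; rfl)
      (by
        change (multivectorAlgebra E M).l2m p.1.2 (hamVF w (α + β)) = _
        rw [map_add, map_add]; rfl)))
    (fun c p α => Subtype.ext (Prod.ext (ContMDiffMap.ext fun x => by
        change ev1 (iotaB p.1.2.1 w.form) (hamVF w (c • α)) x = _
        rw [map_smul]
        exact alt_cons_smul (E := E) _ c (hamVF w α x) ![])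
      (by
        change (multivectorAlgebra E M).l2m p.1.2 (hamVF w (c • α)) = _
        rw [map_smul, map_smul]; rfl)))

lemma hamPairBracket_diff (p : HamPair w) (f : SmoothFn E M) : hamPairBracket w p (diff w f) = 0 := by
  refine Subtype.ext (Prod.ext (ContMDiffMap.ext fun x => ?_) ?_)
  · change ev1 (iotaB p.1.2.1 w.form) (hamVF w (diff w f)) x = 0
    rw [hamVF_diff, HamPair_eq]
    have := lieD_VF_smul (0 : ℝ) (0 : VF E M) p.1.1 x
    rw [zero_smul, zero_mul] at this
    rw [Pi.neg_apply, this, neg_zero]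
  · change (multivectorAlgebra E M).l2m p.1.2 (hamVF w (diff w f)) = 0
    rw [hamVF_diff, map_zero]

lemma hamPairBracket_rel (p : HamPair w) (α β : HamForm w) :
    hamPairBracket w p (hamBracket w α β) + hamPairBracket w (hamPairBracket w p β) α
      - hamPairBracket w (hamPairBracket w p α) β = 0 := by
  refine Subtype.ext (Prod.ext (ContMDiffMap.ext fun x => ?_) ?_)
  · change ev1 (iotaB p.1.2.1 w.form) (hamVF w (hamBracket w α β)) x
      + ev1 (iotaB (hamPairBracket w p β).1.2.1 w.form) (hamVF w α) x
      - ev1 (iotaB (hamPairBracket w p α).1.2.1 w.form) (hamVF w β) x = 0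
    have e : ∀ α : HamForm w, ((hamPairBracket w p α).1.1 : M → ℝ) = -lieD (hamVF w α) p.1.1 :=
      fun α => HamPair_eq w p (hamVF w α)
    rw [HamPair_eq, HamPair_eq, HamPair_eq, hamVF_bracket, e, e]
    simp only [Pi.neg_apply, lieD_bracket _ _ p.1.1.contMDiff,
      lieD_neg _ (lieD_smooth _ p.1.1.contMDiff)]
    ring
  · have h := (multivectorAlgebra E M).rel5 p.1.2 (hamVF w α) (hamVF w β)
    change (multivectorAlgebra E M).l2m p.1.2 (hamVF w (hamBracket w α β))
      + (multivectorAlgebra E M).l2m ((multivectorAlgebra E M).l2m p.1.2 (hamVF w β)) (hamVF w α)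
      - (multivectorAlgebra E M).l2m ((multivectorAlgebra E M).l2m p.1.2 (hamVF w α)) (hamVF w β) = 0
    rw [hamVF_bracket]
    exact h.symm

/-- The Lie 2-algebra `D̃²(M, ω)`, with triples `(f', (f, v))` of a function and a Hamiltonian pair in
degree `-1` and Hamiltonian `1`-forms in degree `0`. Its brackets are `l₁(f', (f, v)) = df'`,
`l₂(α, β) = ι_{X_α ∧ X_β} ω`, `l₂((f', (f, v)), α) = (0, (ι_{v ∧ X_α} ω, [v, X_α]))` and
`l₃(α, β, γ) = (-ω(X_α, X_β, X_γ), (0, 0))`. -/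
def delgadoAlgebra : Lie2Algebra (SmoothFn E M × HamPair w) (HamForm w) where
  l1 := diff w ∘ₗ LinearMap.fst ℝ (SmoothFn E M) (HamPair w)
  l2 := hamBracket w
  l2m := LinearMap.mk₂ ℝ (fun p α => (0, hamPairBracket w p.2 α))
    (fun p q α => Prod.ext (add_zero _).symm (LinearMap.map_add₂ (hamPairBracket w) p.2 q.2 α))
    (fun c p α => Prod.ext (smul_zero _).symm (LinearMap.map_smul₂ (hamPairBracket w) c p.2 α))
    (fun p α β => Prod.ext (add_zero _).symm ((hamPairBracket w p.2).map_add α β))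
    (fun c p α => Prod.ext (smul_zero _).symm ((hamPairBracket w p.2).map_smul c α))
  l3 := LinearMap.mk₂ ℝ (fun α β => LinearMap.inl ℝ (SmoothFn E M) (HamPair w) ∘ₗ hamTriple w α β)
    (fun α α' β => by rw [map_add, LinearMap.add_apply, LinearMap.comp_add])
    (fun c α β => by rw [map_smul, LinearMap.smul_apply, LinearMap.comp_smul])
    (fun α β β' => by rw [map_add, LinearMap.comp_add])
    (fun c α β => by rw [map_smul, LinearMap.comp_smul])
  l2_self := hamBracket_self w
  l3_self_left α β := Prod.ext (hamTriple_self_left w α β) rfl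
  l3_self_right α β := Prod.ext (hamTriple_self_right w α β) rfl
  rel2 a x := by
    change diff w (-0) = hamBracket w x (diff w a.1)
    rw [hamBracket_diff, neg_zero, map_zero]
  rel3 a b := Prod.ext neg_zero (by
    change -hamPairBracket w b.2 (diff w a.1) = hamPairBracket w a.2 (diff w b.1)
    rw [hamPairBracket_diff, hamPairBracket_diff, neg_zero])
  rel4 := diff_hamTriple w
  rel5 a x y := Prod.ext
    (by
      change hamTriple w (diff w a.1) x y = 0 + 0 - 0
      rw [hamTriple_diff]; simp)
    (hamPairBracket_rel w a.2 x y).symm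
  rel6 x y z t := Prod.ext
    (by
      have h := hamTriple_rel w x y z t
      refine Eq.trans h ?_
      change (0 : SmoothFn E M) = 0 - 0 + 0 - 0
      simp)
    (by
      change (0 : HamPair w) - 0 + 0 + 0 - 0 + 0 = hamPairBracket w 0 t - hamPairBracket w 0 z
        + hamPairBracket w 0 y - hamPairBracket w 0 x
      simp)

/-- The strict morphism `I` with `I₁₀ = id` and `I₁₋₁ f' = (f', (0, 0))`. -/
def inclusion : Lie2Hom (rogersAlgebra w) (delgadoAlgebra w) where
  F10 := LinearMap.id
  F1m := LinearMap.inl ℝ (SmoothFn E M) (HamPair w)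
  F2 := 0
  F2_self _ := rfl
  rel1 _ := rfl
  rel2 x y := by
    change diff w 0 = hamBracket w x y - hamBracket w x y
    rw [sub_self, map_zero]
  rel3 f x := Prod.ext
    (by change (0 : SmoothFn E M) = 0 + 0; simp)
    (by change (0 : HamPair w) = 0 + hamPairBracket w 0 x; simp)
  rel4 x y z := by
    simp only [LinearMap.zero_apply, map_zero, neg_zero, sub_zero, add_zero]
    rfl

/-- The strict morphism `Φ` with `Φ₁₀ = id` and `Φ₁₋₁ (f', (f, v)) = f'`. -/
def projection : Lie2Hom (delgadoAlgebra w) (rogersAlgebra w) where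
  F10 := LinearMap.id
  F1m := LinearMap.fst ℝ (SmoothFn E M) (HamPair w)
  F2 := 0
  F2_self _ := rfl
  rel1 _ := rfl
  rel2 x y := by
    change diff w 0 = hamBracket w x y - hamBracket w x y
    rw [sub_self, map_zero]
  rel3 p x := by
    change (0 : SmoothFn E M) = 0 + 0
    simp
  rel4 x y z := by
    simp only [LinearMap.zero_apply, map_zero, neg_zero, sub_zero, add_zero]
    rfl

/-- The strict 2-plectic gradient `Ψ`, with `Ψ₁₀ α = X_α`, `Ψ₁₋₁ (f', (f, v)) = v` and `Ψ₂ = 0`. -/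
def strictGradient : Lie2Hom (delgadoAlgebra w) (multivectorAlgebra E M) where
  F10 := hamVF w
  F1m := LinearMap.snd ℝ (SmoothFn E M) (BivectorField E M) ∘ₗ (HamPair w).subtype ∘ₗ
    LinearMap.snd ℝ (SmoothFn E M) (HamPair w)
  F2 := 0
  F2_self _ := rfl
  rel1 p := by
    change (0 : VF E M) = hamVF w (diff w p.1)
    rw [hamVF_diff]
  rel2 x y := by
    change (0 : VF E M) = hamVF w (hamBracket w x y) - bracket (hamVF w x) (hamVF w y)
    rw [hamVF_bracket, sub_self]
  rel3 p x := by
    change (multivectorAlgebra E M).l2m p.2.1.2 (hamVF w x) =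
      0 + (multivectorAlgebra E M).l2m p.2.1.2 (hamVF w x)
    rw [zero_add]
  rel4 x y z := by
    simp only [LinearMap.zero_apply, map_zero, neg_zero, sub_zero, add_zero]
    rfl

end

/-- `ρ₀` is an infinitesimal action of `(g₀, l₂)` on `M` by Hamiltonian vector fields. -/
structure IsHamiltonianAction (w : TwoPlecticForm E M) {g₁ g₀ : Type*} [AddCommGroup g₁] [Module ℝ g₁]
    [AddCommGroup g₀] [Module ℝ g₀] (g : Lie2Algebra g₁ g₀) (ρ₀ : g₀ →ₗ[ℝ] VF E M) : Prop where
  map_bracket : ∀ x y, ρ₀ (g.l2 x y) = bracket (ρ₀ x) (ρ₀ y)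
  hamiltonian : ∀ x, ∃ α ∈ Form E M 1, IsHamiltonianFor w.form α (ρ₀ x)

/-- `μ` is a homotopy comomentum map for the infinitesimal action `ρ₀` by Hamiltonian vector fields
`v_x = ρ₀ x`: a morphism to `L²(M, ω)` with `-ι_{v_x} ω = d(μ₁₀ x)`. -/
structure IsHomotopyComomentumMap [T2Space M] (w : TwoPlecticForm E M) {g₁ g₀ : Type*} [AddCommGroup g₁] [Module ℝ g₁]
    [AddCommGroup g₀] [Module ℝ g₀] (g : Lie2Algebra g₁ g₀) (ρ₀ : g₀ →ₗ[ℝ] VF E M)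
    (μ : Lie2Hom g (rogersAlgebra w)) : Prop where
  action : IsHamiltonianAction w g ρ₀
  moment : ∀ x p, -iota (ρ₀ x) w.form p = extD (μ.F10 x : M → E [⋀^Fin 1]→L[ℝ] ℝ) p

/-- `μ` is a 2-comomentum map for the 2-action `ρ` along `Ψ`: `Ψ ∘ μ = ρ` as morphisms of Lie
2-algebras. A 2-action of `g` is a morphism from `g` to `multivectorAlgebra E M`. -/
def IsTwoComomentumMap [T2Space M] {w : TwoPlecticForm E M} {g₁ g₀ : Type*} [AddCommGroup g₁] [Module ℝ g₁]
    [AddCommGroup g₀] [Module ℝ g₀] {g : Lie2Algebra g₁ g₀}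
    (Ψ : Lie2Hom (delgadoAlgebra w) (multivectorAlgebra E M)) (ρ : Lie2Hom g (multivectorAlgebra E M))
    (μ : Lie2Hom g (delgadoAlgebra w)) : Prop := Ψ.comp μ = ρ

end

end Plectic

end

/-!
The composite `Ψ ∘ I : L²(M, ω) → 𝔛²(M) ⊕ 𝔛¹(M)` is the strict morphism `(α ↦ X_α, 0, 0)`, so
composing it with any morphism `μ : g → L²(M, ω)` gives the 2-action `(x ↦ X_{μ₁₀ x}, 0, 0)`; its
degree `0` part preserves brackets because `l₁ = 0` on `𝔛²(M) ⊕ 𝔛¹(M)`. By nondegeneracy of `ω`,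
the moment condition amounts to `X_{μ₁₀ x} = ρ₀ x`, and this equation characterises the homotopy
comomentum maps for `ρ₀`. Conversely, the degree `0` part of `Ψ ∘ λ = ρ` reads `X_{λ₁₀ x} = ρ₁₀ x`,
and `Φ ∘ λ` has the same degree `0` part as `λ`.
-/

namespace Plectic

section Lie2Hom

variable {L₁ L₀ L₁' L₀' L₁'' L₀'' L₁''' L₀''' : Type*}
  [AddCommGroup L₁] [Module ℝ L₁] [AddCommGroup L₀] [Module ℝ L₀]
  [AddCommGroup L₁'] [Module ℝ L₁'] [AddCommGroup L₀'] [Module ℝ L₀']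
  [AddCommGroup L₁''] [Module ℝ L₁''] [AddCommGroup L₀''] [Module ℝ L₀'']
  [AddCommGroup L₁'''] [Module ℝ L₁'''] [AddCommGroup L₀'''] [Module ℝ L₀''']
  {L : Lie2Algebra L₁ L₀} {L' : Lie2Algebra L₁' L₀'} {L'' : Lie2Algebra L₁'' L₀''}
  {L''' : Lie2Algebra L₁''' L₀'''}

theorem Lie2Hom.comp_assoc (H : Lie2Hom L'' L''') (G : Lie2Hom L' L'') (F : Lie2Hom L L') :
    (H.comp G).comp F = H.comp (G.comp F) := by
  refine Lie2Hom.ext rfl rfl (LinearMap.ext₂ fun x y => ?_)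
  simp [Lie2Hom.comp, add_assoc]

theorem Lie2Hom.comp_F1m_eq_zero {G : Lie2Hom L' L''} (hG : G.F1m = 0) (F : Lie2Hom L L') :
    (G.comp F).F1m = 0 := by
  simp [Lie2Hom.comp, hG]

theorem Lie2Hom.comp_F2_eq_zero {G : Lie2Hom L' L''} (hG₁ : G.F1m = 0) (hG₂ : G.F2 = 0)
    (F : Lie2Hom L L') : (G.comp F).F2 = 0 := by
  ext x y
  simp [Lie2Hom.comp, hG₁, hG₂]

theorem Lie2Hom.F10_l2_of_l1_eq_zero (hL' : L'.l1 = 0) (F : Lie2Hom L L') (x y : L₀) :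
    F.F10 (L.l2 x y) = L'.l2 (F.F10 x) (F.F10 y) := by
  rw [← sub_eq_zero, ← F.rel2, hL', LinearMap.zero_apply]

end Lie2Hom

variable {E : Type*} [NormedAddCommGroup E] [NormedSpace ℝ E] [FiniteDimensional ℝ E]
  {M : Type*} [TopologicalSpace M] [ChartedSpace E M] [IsManifold 𝓘(ℝ, E) ∞ M]
  {w : TwoPlecticForm E M}

theorem hamVF_eq_iff {α : HamForm w} {X : VF E M} :
    hamVF w α = X ↔ IsHamiltonianFor w.form α X :=
  ⟨fun h => h ▸ hamVF_spec w α, hamVF_eq w α⟩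

variable [T2Space M] {g₁ g₀ : Type*} [AddCommGroup g₁] [Module ℝ g₁] [AddCommGroup g₀]
  [Module ℝ g₀] {g : Lie2Algebra g₁ g₀}

variable (w) in
theorem strictGradient_comp_inclusion_F1m : ((strictGradient w).comp (inclusion w)).F1m = 0 :=
  rfl

variable (w) in
theorem strictGradient_comp_inclusion_F2 : ((strictGradient w).comp (inclusion w)).F2 = 0 := by
  ext α β
  simp [Lie2Hom.comp, strictGradient, inclusion]

theorem isHamiltonianAction_hamVF_comp_F10 (μ : Lie2Hom g (rogersAlgebra w)) :
    IsHamiltonianAction w g (hamVF w ∘ₗ μ.F10) where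
  map_bracket := (((strictGradient w).comp (inclusion w)).comp μ).F10_l2_of_l1_eq_zero rfl
  hamiltonian x := ⟨μ.F10 x, HamForm.mem_form w (μ.F10 x), hamVF_spec w (μ.F10 x)⟩

theorem isHomotopyComomentumMap_iff_hamVF_comp_F10_eq {ρ₀ : g₀ →ₗ[ℝ] VF E M}
    {μ : Lie2Hom g (rogersAlgebra w)} :
    IsHomotopyComomentumMap w g ρ₀ μ ↔ hamVF w ∘ₗ μ.F10 = ρ₀ where
  mp h := LinearMap.ext fun x => hamVF_eq_iff.2 fun p => (h.moment x p).symm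
  mpr h := by
    subst h
    exact ⟨isHamiltonianAction_hamVF_comp_F10 μ, fun x p => (hamVF_spec w (μ.F10 x) p).symm⟩

theorem IsTwoComomentumMap.isHomotopyComomentumMap {ρ : Lie2Hom g (multivectorAlgebra E M)}
    {μ : Lie2Hom g (delgadoAlgebra w)} (h : IsTwoComomentumMap (strictGradient w) ρ μ) :
    IsHomotopyComomentumMap w g ρ.F10 ((projection w).comp μ) :=
  isHomotopyComomentumMap_iff_hamVF_comp_F10_eq.2 (congrArg Lie2Hom.F10 h)

end Plectic

open Plectic in
theorem mainTheorem4_general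
    {E : Type*} [NormedAddCommGroup E] [NormedSpace ℝ E] [FiniteDimensional ℝ E]
    {M : Type*} [TopologicalSpace M] [ChartedSpace E M] [IsManifold 𝓘(ℝ, E) ∞ M] [T2Space M]
    (w : TwoPlecticForm E M)
    {g₁ g₀ : Type*} [AddCommGroup g₁] [Module ℝ g₁] [AddCommGroup g₀] [Module ℝ g₀]
    (g : Lie2Algebra g₁ g₀) :
    (∀ (ρ₀ : g₀ →ₗ[ℝ] VF E M) (μ : Lie2Hom g (rogersAlgebra w)),
      IsHomotopyComomentumMap w g ρ₀ μ →
        ∃ ρ : Lie2Hom g (multivectorAlgebra E M),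
          ρ.F10 = ρ₀ ∧ ρ.F1m = 0 ∧ ρ.F2 = 0 ∧
          IsTwoComomentumMap (strictGradient w) ρ ((inclusion w).comp μ)) ∧
    (∀ (ρ : Lie2Hom g (multivectorAlgebra E M)) (μ : Lie2Hom g (delgadoAlgebra w)),
      IsTwoComomentumMap (strictGradient w) ρ μ →
        IsHamiltonianAction w g ρ.F10 ∧
        IsHomotopyComomentumMap w g ρ.F10 ((projection w).comp μ)) := by
  have hF1m := strictGradient_comp_inclusion_F1m w
  have hF2 := strictGradient_comp_inclusion_F2 w
  refine ⟨fun ρ₀ μ hμ => ⟨((strictGradient w).comp (inclusion w)).comp μ, ?_, ?_, ?_, ?_⟩,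
    fun ρ μ hμ => ⟨?_, ?_⟩⟩
  · exact isHomotopyComomentumMap_iff_hamVF_comp_F10_eq.1 hμ
  · exact Lie2Hom.comp_F1m_eq_zero hF1m μ
  · exact Lie2Hom.comp_F2_eq_zero hF1m hF2 μ
  · exact (Lie2Hom.comp_assoc _ _ μ).symm
  · exact hμ.isHomotopyComomentumMap.action
  · exact hμ.isHomotopyComomentumMap

theorem mainTheorem4
    {E : Type*} [NormedAddCommGroup E] [NormedSpace ℝ E] [FiniteDimensional ℝ E]
    {M : Type*} [TopologicalSpace M] [ChartedSpace E M] [IsManifold 𝓘(ℝ, E) ∞ M] [T2Space M]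
    (w : Plectic.TwoPlecticForm E M)
    {g₁ g₀ : Type*} [AddCommGroup g₁] [Module ℝ g₁] [AddCommGroup g₀] [Module ℝ g₀]
    (g : Plectic.Lie2Algebra g₁ g₀) (hg : g.ZeroIsLie) :
    (∀ (ρ₀ : g₀ →ₗ[ℝ] Plectic.VF E M) (μ : Plectic.Lie2Hom g (Plectic.rogersAlgebra w)),
      Plectic.IsHomotopyComomentumMap w g ρ₀ μ →
        ∃ ρ : Plectic.Lie2Hom g (Plectic.multivectorAlgebra E M),
          ρ.F10 = ρ₀ ∧ ρ.F1m = 0 ∧ ρ.F2 = 0 ∧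
          Plectic.IsTwoComomentumMap (Plectic.strictGradient w) ρ
            ((Plectic.inclusion w).comp μ)) ∧
    (∀ (ρ : Plectic.Lie2Hom g (Plectic.multivectorAlgebra E M))
      (μ : Plectic.Lie2Hom g (Plectic.delgadoAlgebra w)),
      ρ.F1m = 0 → ρ.F2 = 0 →
      Plectic.IsTwoComomentumMap (Plectic.strictGradient w) ρ μ →
        Plectic.IsHamiltonianAction w g ρ.F10 ∧
        Plectic.IsHomotopyComomentumMap w g ρ.F10 ((Plectic.projection w).comp μ)) := by
  obtain ⟨toTwo, toHomotopy⟩ := mainTheorem4_general w g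
  exact ⟨toTwo, fun ρ μ _ _ hμ => toHomotopy ρ μ hμ⟩
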